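/- Theorem 1. The Mordell–Weil rank is not a sum of local invariants. That is: there is no function $\lambda$ which assigns to every elliptic curve $E$ over a local field $k$ an integer $\lambda(E/k)$, depending only on the isomorphism class of the pair $(k,E)$ (if $k\cong k'$ as topological fields and, identifying $k$ with $k'$, the curves $E/k$ and $E'/k'$ are isomorphic, then $\lambda(E/k)=\lambda(E'/k')$), such that for every number field $K$ and every elliptic curve $E/K$ one has $\lambda(E/K_v)=0$ for all but finitely many places $v$ of $K$ and $$\operatorname{rk} E(K)=\sum_{v}\lambda(E/K_v),$$ where $v$ runs over all (finite and infinite) places of $K$ and $K_v$ is the completion of $K$ at $v$. -/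

import Mathlib

open IsDedekindDomain NumberField

/-- A local field: a Hausdorff, locally compact, non-discrete topological field
(that is `ℝ`, `ℂ`, a finite extension of `ℚ_p`, or a field `𝔽_q((t))`). -/
class IsLocalField (k : Type*) [Field k] [TopologicalSpace k] : Prop extends
    IsTopologicalDivisionRing k, T2Space k, LocallyCompactSpace k where
  not_discreteTopology : ¬ DiscreteTopology k

section Completions

variable (K : Type*) [Field K] [NumberField K]

theorem not_discreteTopology_of_norm_lt_one {k : Type*} [NormedField k] (x : k) (hx : x ≠ 0)
    (hx1 : ‖x‖ < 1) : ¬ DiscreteTopology k := by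
  intro _
  have h := tendsto_pow_atTop_nhds_zero_of_norm_lt_one hx1
  rw [nhds_discrete, Filter.tendsto_pure, Filter.eventually_atTop] at h
  obtain ⟨n, hn⟩ := h
  exact pow_ne_zero n hx (hn n le_rfl)

theorem finite_residueField_adicCompletion (v : HeightOneSpectrum (𝓞 K)) :
    Finite (Valued.ResidueField (v.adicCompletion K)) := by
  have hfin : Finite (𝓞 K ⧸ v.asIdeal) := v.asIdeal.finiteQuotientOfFreeOfNeBot v.ne_bot
  let f : 𝓞 K →+* Valued.integer (v.adicCompletion K) :=
    (algebraMap (𝓞 K) (v.adicCompletion K)).codRestrict _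
      (fun r => HeightOneSpectrum.coe_algebraMap_mem _ K v r)
  let g : 𝓞 K →+* Valued.ResidueField (v.adicCompletion K) := (IsLocalRing.residue _).comp f
  have key (x : Valued.integer (v.adicCompletion K))
      (hx : Valued.v (x : v.adicCompletion K) < 1) : IsLocalRing.residue _ x = 0 := by
    rw [IsLocalRing.residue_eq_zero_iff]
    exact (Valuation.mem_maximalIdeal_iff _ _).2 hx
  have hg (r : 𝓞 K) (hr : r ∈ v.asIdeal) : g r = 0 := by
    refine key _ ?_
    change Valued.v (((r : K)) : v.adicCompletion K) < 1
    rw [HeightOneSpectrum.valuedAdicCompletion_eq_valuation']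
    exact (v.valuation_lt_one_iff_mem r).2 hr
  refine Finite.of_surjective (Ideal.Quotient.lift v.asIdeal g hg) ?_
  refine Ideal.Quotient.lift_surjective_of_surjective _ _ fun y => ?_
  obtain ⟨x, rfl⟩ := IsLocalRing.residue_surjective y
  have hopen : IsOpen {z : v.adicCompletion K | Valued.v (z - x) < 1} := by
    have h1 : {z : v.adicCompletion K | Valued.v (z - x) < 1} = Metric.ball (x : v.adicCompletion K) 1 := by
      ext z
      rw [Metric.mem_ball, dist_eq_norm, Set.mem_ofPred_eq]
      exact Valued.toNormedField.norm_lt_one_iff.symm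
    rw [h1]
    exact Metric.isOpen_ball
  obtain ⟨c, hc⟩ := (HeightOneSpectrum.denseRange_algebraMap K v).exists_mem_open hopen
    ⟨x, by simp⟩
  have hc' : Valued.v ((c : v.adicCompletion K) - x) < 1 := hc
  have hc1 : v.valuation K c ≤ 1 := by
    rw [← HeightOneSpectrum.valuedAdicCompletion_eq_valuation']
    have := Valued.v.map_add ((c : v.adicCompletion K) - x) x
    rw [sub_add_cancel] at this
    exact this.trans (max_le hc'.le x.2)
  obtain ⟨a, ha⟩ := v.exists_valuation_sub_lt_of_integer hc1 1
  refine ⟨a, ?_⟩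
  change IsLocalRing.residue _ (f a) = _
  rw [← sub_eq_zero, ← map_sub]
  refine key _ ?_
  have ha' : Valued.v (((a : K) : v.adicCompletion K) - (c : v.adicCompletion K)) < 1 := by
    rw [← HeightOneSpectrum.valuedAdicCompletion_eq_valuation'] at ha
    have h2 : (((a : K) - c : K) : v.adicCompletion K) = (a : K) - (c : v.adicCompletion K) :=
      map_sub (algebraMap K (v.adicCompletion K)) _ _
    rw [← h2]
    exact ha
  have := Valued.v.map_add (((a : K) : v.adicCompletion K) - (c : v.adicCompletion K)) (c - x)
  rw [sub_add_sub_cancel] at this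
  exact this.trans_lt (max_lt ha' hc')

instance isLocalField_adicCompletion (v : HeightOneSpectrum (𝓞 K)) :
    IsLocalField (v.adicCompletion K) where
  toLocallyCompactSpace := by
    have h : ProperSpace (v.adicCompletion K) := Valued.integer.properSpace_iff_completeSpace_and_isDiscreteValuationRing_integer_and_finite_residueField.2
        ⟨inferInstance, inferInstanceAs (IsDiscreteValuationRing (v.adicCompletionIntegers K)),
          finite_residueField_adicCompletion K v⟩
    infer_instance
  not_discreteTopology := by
    obtain ⟨x, hx⟩ := v.valuation_exists_uniformizer K
    have hv : Valued.v (x : v.adicCompletion K) < 1 := by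
      rw [HeightOneSpectrum.valuedAdicCompletion_eq_valuation', hx, ← WithZero.exp_zero,
        WithZero.exp_lt_exp]
      norm_num
    have h0 : (x : v.adicCompletion K) ≠ 0 := by
      intro h
      have h1 := congrArg Valued.v h
      rw [HeightOneSpectrum.valuedAdicCompletion_eq_valuation', hx, map_zero] at h1
      exact WithZero.exp_ne_zero h1
    exact not_discreteTopology_of_norm_lt_one (x : v.adicCompletion K) h0
      (Valued.toNormedField.norm_lt_one_iff.2 hv)

instance isLocalField_infinitePlace_completion (v : InfinitePlace K) :
    IsLocalField v.Completion where
  not_discreteTopology := by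
    have h2 : ‖(2 : v.Completion)‖ = 2 := by
      have h := (InfinitePlace.Completion.isometry_extensionEmbedding v).norm_map_of_map_zero
        (map_zero _) 2
      rw [← h, map_ofNat]
      norm_num
    refine not_discreteTopology_of_norm_lt_one (2 : v.Completion)⁻¹ (inv_ne_zero ?_) ?_
    · intro h
      simp [h] at h2
    · rw [norm_inv, h2]
      norm_num

end Completions

/-- An invariant of elliptic curves over local fields, with values in `A`. -/
structure LocalInvariant (A : Type*) where
  /-- The value `λ(E/k)` on the elliptic curve `E` over the local field `k`. -/
  toFun : ∀ (k : Type) [Field k] [TopologicalSpace k] [IsLocalField k]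
    (E : WeierstrassCurve k) [E.IsElliptic], A
  /-- If `φ : k ≃ k'` is an isomorphism of topological fields and the base change of `E/k` along
  `φ` is isomorphic to `E'/k'`, then `λ(E/k) = λ(E'/k')`. -/
  iso_invariant : ∀ (k k' : Type) [Field k] [TopologicalSpace k] [IsLocalField k]
    [Field k'] [TopologicalSpace k'] [IsLocalField k']
    (φ : k ≃+* k') (_ : Continuous φ) (_ : Continuous φ.symm)
    (E : WeierstrassCurve k) [E.IsElliptic] (E' : WeierstrassCurve k') [E'.IsElliptic]
    (C : WeierstrassCurve.VariableChange k'),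
    C • E.map (φ : k →+* k') = E' → toFun k E = toFun k' E'

/-- The assignment `Λ`, sending an elliptic curve `E` over a number field `K` to `Λ(E/K) ∈ A`, is a
sum of local invariants: there is an invariant `l` of elliptic curves over local fields such that
`l(E/K_v) = 0` for all but finitely many places `v` of `K` and `Λ(E/K) = ∑_v l(E/K_v)`, the sum
being over all (finite and infinite) places. -/
def IsSumOfLocalInvariants {A : Type*} [AddCommGroup A]
    (Λ : ∀ (K : Type) [Field K] [NumberField K] (E : WeierstrassCurve K) [E.IsElliptic], A) :
    Prop :=
  ∃ l : LocalInvariant A,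
    ∀ (K : Type) [Field K] [NumberField K] (E : WeierstrassCurve K) [E.IsElliptic],
      {v : HeightOneSpectrum (𝓞 K) |
        l.toFun (v.adicCompletion K) (E.map (algebraMap K (v.adicCompletion K))) ≠ 0}.Finite ∧
      Λ K E =
        (∑ᶠ v : HeightOneSpectrum (𝓞 K),
          l.toFun (v.adicCompletion K) (E.map (algebraMap K (v.adicCompletion K)))) +
        ∑ v : InfinitePlace K, l.toFun v.Completion (E.map (algebraMap K v.Completion))

open Classical in
/-- The Mordell-Weil rank `rk E/K`: the rank of the abelian group `E(K)`. -/
noncomputable def mordellWeilRank (K : Type) [Field K] [NumberField K]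
    (E : WeierstrassCurve K) [E.IsElliptic] : ℤ :=
  (Module.finrank ℤ E.toAffine.Point : ℤ)

/-! ### Cubes in the Eisenstein integers -/

section Eisenstein

local notation "K₃" => CyclotomicField 3 ℚ

/-! The obstruction lives modulo 3, in a family of cubic twists over ℚ. Let E_n be the curve y² + ny
= x³. Rescaling identifies E_m with E_n over k as soon as m/n is a cube in k, so a local invariant
sees n only modulo cubes. In every completion of ℚ one of 5, 2, 10, 50 is a cube: for p ∤ 30 because
𝔽_p^× modulo cubes has order 1 or 3, and Hensel lifts; the other places are checked directly. If 5
is a cube, λ is constant on {E₁, E₅, E₂₅} and on {E₂, E₁₀, E₅₀}; in the other three cases λ takes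
the same values on both triples. So the sum of λ over the first triple minus that over the second is
divisible by 3 at every place (`LocalInvariant.three_dvd_cubicValue`). If the rank were a sum of
local invariants, the same combination of ranks would be divisible by 3. It is not: E₁, E₅, E₂₅, E₂
have rank 0, E₅₀ has rank 1 and E₁₀ has rank at most 1, which makes it -1 or -2.

The ranks come from a 3-descent. For p = 2, 5 the map (x, y) ↦ v_p(y) mod 3 is a homomorphism
(`descentHom`). On the common kernel y and y + n are cubes, which gives a solution of A³ + B³ = nC³;
factoring in ℤ[ω] shows that the point is 3R for a rational R (`exists_three_nsmul_eq`). Hence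
E_n(ℚ)/3 has at most 9 elements, and at most 3 if only one of the two primes divides n. Heights then
give finite generation (`fg_of_finiteIndex`), and the point (0, 0) of order 3 lowers the rank bound
by one (`finrank_le_of_index_le`). For n = 50 the point (6, 4) forces positive rank. The curve E₁
has no prime to descend with and is settled by Fermat's theorem for exponent 3. -/

theorem isCyclotomicExtension_three : IsCyclotomicExtension {3} ℚ K₃ :=
  have : NeZero ((3 : ℕ) : ℚ) := ⟨by norm_num⟩
  CyclotomicField.isCyclotomicExtension 3 ℚ

theorem exists_eisensteinInteger_basis : ∃ w : 𝓞 K₃, w ^ 2 + w + 1 = 0 ∧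
    (∀ z : 𝓞 K₃, ∃ p q : ℤ, z = p + q * w) ∧
    ∀ u : (𝓞 K₃)ˣ, (u : 𝓞 K₃) ∈ [1, -1, w, -w, w ^ 2, -w ^ 2] := by
  have := isCyclotomicExtension_three
  have hζ := IsCyclotomicExtension.zeta_spec 3 ℚ K₃
  have h0 : hζ.toInteger ^ 2 + hζ.toInteger + 1 = 0 :=
    IsCyclotomicExtension.Rat.Three.eta_sq_add_eta_add_one hζ
  refine ⟨hζ.toInteger, h0, fun z => ?_, fun u => ?_⟩
  · obtain ⟨f, hf⟩ := hζ.integralPowerBasis.exists_eq_aeval' z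
    rw [hf, hζ.integralPowerBasis_gen]
    clear hf
    induction f using Polynomial.induction_on' with
    | add f g hf hg =>
      obtain ⟨p, q, h⟩ := hf
      obtain ⟨p', q', h'⟩ := hg
      exact ⟨p + p', q + q', by rw [map_add, h, h']; push_cast; ring⟩
    | monomial n a =>
      rw [Polynomial.aeval_monomial]
      induction n with
      | zero => exact ⟨a, 0, by simp⟩
      | succ n ih =>
        obtain ⟨p, q, h⟩ := ih
        refine ⟨-q, p - q, ?_⟩
        rw [pow_succ, ← mul_assoc, h]
        push_cast
        linear_combination (q : 𝓞 K₃) * h0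
  · have := IsCyclotomicExtension.Rat.Three.Units.mem hζ u
    simp only [List.mem_cons, List.not_mem_nil, or_false] at this ⊢
    rcases this with rfl | rfl | rfl | rfl | rfl | rfl <;>
      simp

theorem eq_zero_of_sq_sub_mul_add_sq {x y : ℤ} (h : x ^ 2 - x * y + y ^ 2 = 0) :
    x = 0 ∧ y = 0 := by
  constructor <;> nlinarith [sq_nonneg (2 * x - y), sq_nonneg (2 * y - x), sq_nonneg x, sq_nonneg y]

/-- If the norm of a primitive Eisenstein integer `a + bω` is a cube prime to `3`, then `a + bω` is
`ω ^ i` times a cube. -/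
theorem eisenstein_eq_cube {a b d : ℤ} (hab : IsCoprime a b) (h3 : ¬ 3 ∣ a ^ 2 - a * b + b ^ 2)
    (hd : a ^ 2 - a * b + b ^ 2 = d ^ 3) :
    ∃ p q : ℤ,
      (a = p ^ 3 + q ^ 3 - 3 * p * q ^ 2 ∧ b = 3 * p ^ 2 * q - 3 * p * q ^ 2) ∨
      (a = -(3 * p ^ 2 * q - 3 * p * q ^ 2) ∧
        b = (p ^ 3 + q ^ 3 - 3 * p * q ^ 2) - (3 * p ^ 2 * q - 3 * p * q ^ 2)) ∨
      (a = (3 * p ^ 2 * q - 3 * p * q ^ 2) - (p ^ 3 + q ^ 3 - 3 * p * q ^ 2) ∧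
        b = -(p ^ 3 + q ^ 3 - 3 * p * q ^ 2)) := by
  obtain ⟨w, hw, hrep, hunit⟩ := exists_eisensteinInteger_basis
  -- Coordinates in the basis 1, w are unique: the difference times its conjugate is the norm form,
  -- which is definite.
  have inj {x y x' y' : ℤ} (h : (x + y * w : 𝓞 K₃) = x' + y' * w) : x = x' ∧ y = y' := by
    have h1 : (((x - x') ^ 2 - (x - x') * (y - y') + (y - y') ^ 2 : ℤ) : 𝓞 K₃) = 0 := by
      push_cast
      linear_combination ((x - x') + (y - y') * w ^ 2 : 𝓞 K₃) * h +
        (- (x - x') * (y - y') - (y - y') ^ 2 * (w - 1) : 𝓞 K₃) * hw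
    have := eq_zero_of_sq_sub_mul_add_sq (Int.cast_eq_zero.1 h1)
    omega
  have hprod : (a + b * w : 𝓞 K₃) * (a + b * w ^ 2) = (d : 𝓞 K₃) ^ 3 := by
    have : ((a ^ 2 - a * b + b ^ 2 : ℤ) : 𝓞 K₃) = ((d ^ 3 : ℤ) : 𝓞 K₃) := by rw [hd]
    push_cast at this
    linear_combination this + (a * b + b ^ 2 * (w - 1) : 𝓞 K₃) * hw
  have hcop : IsCoprime (a + b * w : 𝓞 K₃) (a + b * w ^ 2) := by
    obtain ⟨u, v, huv⟩ := hab
    have h3' : IsCoprime (3 : ℤ) (a ^ 2 - a * b + b ^ 2) :=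
      (Int.prime_three.coprime_iff_not_dvd).2 h3
    obtain ⟨s, t, hst⟩ := h3'
    have huv' : ((u * a + v * b : ℤ) : 𝓞 K₃) = 1 := by rw [huv, Int.cast_one]
    have hst' : ((s * 3 + t * (a ^ 2 - a * b + b ^ 2) : ℤ) : 𝓞 K₃) = 1 := by rw [hst, Int.cast_one]
    push_cast at huv' hst'
    -- `X` is the combination giving `w - w ^ 2`
    obtain ⟨X, Y, hXY⟩ : ∃ X Y : 𝓞 K₃, X * (a + b * w) + Y * (a + b * w ^ 2) = w - w ^ 2 := by
      refine ⟨-u * w ^ 2 + v, u * w - v, ?_⟩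
      linear_combination (w - w ^ 2) * huv'
    -- Since (w² - w)(w - w²) = 3, the ideal of the two conjugate factors contains 3 as well as
    -- their product, the norm, which is prime to 3.
    refine ⟨s * (w ^ 2 - w) * X + t * (a + b * w ^ 2), s * (w ^ 2 - w) * Y, ?_⟩
    linear_combination s * (w ^ 2 - w) * hXY + hst' +
      (t * (a * b + b ^ 2 * (w - 1)) - s * (w ^ 2 - 3 * w + 3)  : 𝓞 K₃) * hw
  have := isCyclotomicExtension_three
  have : IsPrincipalIdealRing (𝓞 K₃) := IsCyclotomicExtension.Rat.three_pid K₃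
  obtain ⟨β, u, hu⟩ := exists_associated_pow_of_mul_eq_pow' hcop hprod
  obtain ⟨p, q, rfl⟩ := hrep β
  have hcube : (p + q * w : 𝓞 K₃) ^ 3 = ((p ^ 3 + q ^ 3 - 3 * p * q ^ 2 : ℤ) : 𝓞 K₃) +
      ((3 * p ^ 2 * q - 3 * p * q ^ 2 : ℤ) : 𝓞 K₃) * w := by
    push_cast
    linear_combination (3 * p * q ^ 2 + q ^ 3 * (w - 1) : 𝓞 K₃) * hw
  set A : ℤ := p ^ 3 + q ^ 3 - 3 * p * q ^ 2 with hA
  set B : ℤ := 3 * p ^ 2 * q - 3 * p * q ^ 2 with hB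
  rw [hcube] at hu
  have hmem := hunit u
  simp only [List.mem_cons, List.not_mem_nil, or_false] at hmem
  -- The units are ±wⁱ; the sign is a cube and goes into p and q, so six cases become three.
  rcases hmem with h | h | h | h | h | h <;> rw [h] at hu
  · have := inj (x := A) (y := B) (x' := a) (y' := b) (by linear_combination hu)
    exact ⟨p, q, by grind⟩
  · have := inj (x := -A) (y := -B) (x' := a) (y' := b) (by push_cast; linear_combination hu)
    exact ⟨-p, -q, by grind⟩
  · have := inj (x := -B) (y := A - B) (x' := a) (y' := b)
      (by push_cast; linear_combination hu - B * hw)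
    exact ⟨p, q, by grind⟩
  · have := inj (x := B) (y := B - A) (x' := a) (y' := b)
      (by push_cast; linear_combination hu + B * hw)
    exact ⟨-p, -q, by grind⟩
  · have := inj (x := B - A) (y := -A) (x' := a) (y' := b)
      (by push_cast; linear_combination hu - (A + B * (w - 1)) * hw)
    exact ⟨p, q, by grind⟩
  · have := inj (x := A - B) (y := A) (x' := a) (y' := b)
      (by push_cast; linear_combination hu + (A + B * (w - 1)) * hw)
    exact ⟨-p, -q, by grind⟩

end Eisenstein

/-! ### The integral descent on `A ^ 3 + B ^ 3 = n C ^ 3` -/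

section Descent

/-- The primes 2 and 5 are inert in ℤ[ω], so dividing the norm of a + bω means dividing a + bω
itself. -/
theorem not_dvd_sq_sub_mul_add_sq {p : ℕ} (hp : p = 2 ∨ p = 5) {a b : ℤ} (hab : IsCoprime a b) :
    ¬ (p : ℤ) ∣ a ^ 2 - a * b + b ^ 2 := by
  intro h
  have key : ((p : ℤ) ∣ a) ∧ ((p : ℤ) ∣ b) := by
    rcases hp with rfl | rfl
    · simp only [← ZMod.intCast_zmod_eq_zero_iff_dvd] at h ⊢
      push_cast at h
      generalize (a : ZMod 2) = x at *
      generalize (b : ZMod 2) = y at *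
      revert x y; decide
    · simp only [← ZMod.intCast_zmod_eq_zero_iff_dvd] at h ⊢
      push_cast at h
      generalize (a : ZMod 5) = x at *
      generalize (b : ZMod 5) = y at *
      revert x y; decide
  have := Int.isUnit_iff.1 (hab.isUnit_of_dvd' key.1 key.2)
  omega

/-- Both forms split only over the cubic subfield of ℚ(ζ₉), where 2 and 5 are inert. This is what
excludes the wrong powers of ω in the descent. -/
theorem not_dvd_cubic_form {p : ℕ} (hp : p = 2 ∨ p = 5) {x y : ℤ}
    (hxy : ¬ ((p : ℤ) ∣ x ∧ (p : ℤ) ∣ y)) :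
    ¬ (p : ℤ) ∣ x ^ 3 + y ^ 3 - 3 * x * y ^ 2 ∧
    ¬ (p : ℤ) ∣ x ^ 3 + 3 * x ^ 2 * y - 6 * x * y ^ 2 + y ^ 3 := by
  rcases hp with rfl | rfl
  · simp only [← ZMod.intCast_zmod_eq_zero_iff_dvd] at hxy ⊢
    push_cast
    generalize (x : ZMod 2) = x at *
    generalize (y : ZMod 2) = y at *
    revert x y; decide
  · simp only [← ZMod.intCast_zmod_eq_zero_iff_dvd] at hxy ⊢
    push_cast
    generalize (x : ZMod 5) = x at *
    generalize (y : ZMod 5) = y at *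
    revert x y; decide

theorem eq_mul_cube_of_mul_eq {n x y z : ℤ} (hn : n ≠ 0) (hny : IsCoprime n y)
    (hxy : IsCoprime x y) (h : x * y = n * z ^ 3) :
    ∃ c d : ℤ, x = n * c ^ 3 ∧ y = d ^ 3 := by
  obtain ⟨x', rfl⟩ : n ∣ x := hny.dvd_of_dvd_mul_right ⟨z ^ 3, h⟩
  have h' : x' * y = z ^ 3 := by
    apply mul_left_cancel₀ hn
    linear_combination h
  obtain ⟨⟨c, rfl⟩, d, rfl⟩ := Int.eq_pow_of_mul_eq_pow_odd hxy.of_mul_left_right (by decide) h'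
  exact ⟨c, d, rfl, rfl⟩

theorem Int.cube_injective {x y : ℤ} (hxy : x ^ 3 = y ^ 3) : x = y :=
  (Odd.strictMono_pow (by decide)).injective hxy

theorem not_dvd_and_dvd_of_isCoprime {p : ℕ} (hp : p = 2 ∨ p = 5) {a b : ℤ} (hab : IsCoprime a b) :
    ¬ ((p : ℤ) ∣ a ∧ (p : ℤ) ∣ b) := by
  rintro ⟨h1, h2⟩
  have := Int.isUnit_iff.1 (hab.isUnit_of_dvd' h1 h2)
  omega

theorem dvd_cube_coordinates {d x y : ℤ} (hx : d ∣ x) (hy : d ∣ y) :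
    d ∣ x ^ 3 + y ^ 3 - 3 * x * y ^ 2 ∧ d ∣ 3 * x ^ 2 * y - 3 * x * y ^ 2 := by
  obtain ⟨x, rfl⟩ := hx
  obtain ⟨y, rfl⟩ := hy
  exact ⟨⟨d ^ 2 * (x ^ 3 + y ^ 3 - 3 * x * y ^ 2), by ring⟩,
    ⟨d ^ 2 * (3 * x ^ 2 * y - 3 * x * y ^ 2), by ring⟩⟩

/-- The version of `eisenstein_eq_cube` which records that not both coordinates of the cube root
are divisible by `p`. -/
theorem eisenstein_eq_cube_of_prime {p : ℕ} (hp : p = 2 ∨ p = 5) {a b d : ℤ} (hab : IsCoprime a b)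
    (h3 : ¬ 3 ∣ a ^ 2 - a * b + b ^ 2) (hd : a ^ 2 - a * b + b ^ 2 = d ^ 3) :
    ∃ x y : ℤ, ¬ ((p : ℤ) ∣ x ∧ (p : ℤ) ∣ y) ∧
      ((a = x ^ 3 + y ^ 3 - 3 * x * y ^ 2 ∧ b = 3 * x ^ 2 * y - 3 * x * y ^ 2) ∨
      (a = -(3 * x ^ 2 * y - 3 * x * y ^ 2) ∧
        b = (x ^ 3 + y ^ 3 - 3 * x * y ^ 2) - (3 * x ^ 2 * y - 3 * x * y ^ 2)) ∨
      (a = (3 * x ^ 2 * y - 3 * x * y ^ 2) - (x ^ 3 + y ^ 3 - 3 * x * y ^ 2) ∧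
        b = -(x ^ 3 + y ^ 3 - 3 * x * y ^ 2))) := by
  obtain ⟨x, y, h⟩ := eisenstein_eq_cube hab h3 hd
  refine ⟨x, y, fun ⟨hx, hy⟩ => not_dvd_and_dvd_of_isCoprime hp hab ?_, h⟩
  obtain ⟨h1, h2⟩ := dvd_cube_coordinates hx hy
  rcases h with ⟨ha, hb⟩ | ⟨ha, hb⟩ | ⟨ha, hb⟩ <;> rw [ha, hb]
  · exact ⟨h1, h2⟩
  · exact ⟨(dvd_neg).2 h2, dvd_sub h1 h2⟩
  · exact ⟨dvd_sub h2 h1, (dvd_neg).2 h1⟩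

/-- Descent for `A ^ 3 + B ^ 3 = n C ^ 3` with `3 ∤ C`. -/
theorem exists_descent_of_not_three_dvd {n : ℤ} {p : ℕ} (hp : p = 2 ∨ p = 5) (hpn : (p : ℤ) ∣ n)
    (hn0 : n ≠ 0) {A B C : ℤ} (hAB : IsCoprime A B)
    (hnM : IsCoprime n (A ^ 2 - A * B + B ^ 2)) (h3 : ¬ 3 ∣ A ^ 2 - A * B + B ^ 2)
    (h : (A + B) * (A ^ 2 - A * B + B ^ 2) = n * C ^ 3) :
    ∃ l m c N : ℤ, l * m * (l + m) = n * c ^ 3 ∧ l ^ 2 + l * m + m ^ 2 = 3 * N ∧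
      A + B = n * c ^ 3 ∧ A ^ 2 - A * B + B ^ 2 = N ^ 3 ∧ C = c * N := by
  -- Modulo A + B the norm is -3AB.
  have hcop : IsCoprime (A + B) (A ^ 2 - A * B + B ^ 2) := by
    have h1 : IsCoprime (A + B) A := by
      simpa [add_comm] using hAB.symm.add_mul_right_left 1
    have h2 : IsCoprime (A + B) B := by simpa using hAB.add_mul_right_left 1
    have h3 : IsCoprime (A + B) (-3) :=
      ((Int.prime_three.coprime_iff_not_dvd.2 fun h' => h3 (by
        rw [show A ^ 2 - A * B + B ^ 2 = (A + B) * (A + B) - 3 * (A * B) by ring]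
        exact dvd_sub (h'.mul_right _) (dvd_mul_right _ _))).symm).neg_right
    have := ((h3.mul_right (h1.mul_right h2))).add_mul_left_right (A + B)
    rwa [show -3 * (A * B) + (A + B) * (A + B) = A ^ 2 - A * B + B ^ 2 by ring] at this
  obtain ⟨c, d, hc, hd⟩ := eq_mul_cube_of_mul_eq hn0 hnM hcop h
  have hpm : (p : ℤ) ∣ A + B := hc ▸ hpn.mul_right _
  obtain ⟨x, y, hxy, hcases⟩ := eisenstein_eq_cube_of_prime hp hAB.symm
    (by rwa [show B ^ 2 - B * A + A ^ 2 = A ^ 2 - A * B + B ^ 2 by ring])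
    (by rw [← hd]; ring)
  -- With B + Aω = ωⁱ(x + yω)³, the congruence A + B ≡ 0 mod p rules out i = 0 and 1. For i = 2 the
  -- sum A + B splits as -(2x - y)(x + y)(x - 2y), a product l m (l + m).
  rcases hcases with ⟨hB, hA⟩ | ⟨hB, hA⟩ | ⟨hB, hA⟩
  · refine ((not_dvd_cubic_form hp hxy).2 ?_).elim
    convert hpm using 1
    rw [hA, hB]; ring
  · refine ((not_dvd_cubic_form hp (x := y) (y := x) fun h => hxy h.symm).2 ?_).elim
    convert hpm using 1
    rw [hA, hB]; ring
  · have hN : A ^ 2 - A * B + B ^ 2 = (x ^ 2 - x * y + y ^ 2) ^ 3 := by rw [hA, hB]; ring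
    refine ⟨2 * x - y, -(x + y), c, x ^ 2 - x * y + y ^ 2, ?_, by ring, hc, hN, ?_⟩
    · rw [← hc, hA, hB]; ring
    · apply Int.cube_injective
      apply mul_left_cancel₀ hn0
      rw [← h, hc, hN]; ring

/-- Descent for `A ^ 3 + B ^ 3 = n C ^ 3` with `3 ∣ C`; here `A + B = 3 m`. -/
theorem exists_descent_of_three_dvd {n : ℤ} {p : ℕ} (hp : p = 2 ∨ p = 5) (hpn : (p : ℤ) ∣ n)
    (hn0 : n ≠ 0) {A m C : ℤ} (hAm : IsCoprime A m) (h3A : ¬ 3 ∣ A)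
    (hnM : IsCoprime n (A ^ 2 - 3 * A * m + 3 * m ^ 2))
    (h : m * (A ^ 2 - 3 * A * m + 3 * m ^ 2) = 3 * n * C ^ 3) :
    ∃ l k c N : ℤ, l * k * (l + k) = n * c ^ 3 ∧ l ^ 2 + l * k + k ^ 2 = N ∧
      m = 3 * n * c ^ 3 ∧ A ^ 2 - 3 * A * m + 3 * m ^ 2 = N ^ 3 ∧ C = c * N := by
  have h3 : ¬ 3 ∣ A ^ 2 - 3 * A * m + 3 * m ^ 2 := fun h' => by
    refine h3A (Int.prime_three.dvd_of_dvd_pow (n := 2) ?_)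
    rw [show A ^ 2 = A ^ 2 - 3 * A * m + 3 * m ^ 2 - 3 * (m ^ 2 - A * m) by ring]
    exact dvd_sub h' (dvd_mul_right _ _)
  have hcop : IsCoprime m (A ^ 2 - 3 * A * m + 3 * m ^ 2) := by
    have := (hAm.symm.pow_right (n := 2)).add_mul_left_right (3 * m - 3 * A)
    rwa [show A ^ 2 + m * (3 * m - 3 * A) = A ^ 2 - 3 * A * m + 3 * m ^ 2 by ring] at this
  obtain ⟨c, d, hc, hd⟩ := eq_mul_cube_of_mul_eq (by omega)
    ((Int.prime_three.coprime_iff_not_dvd.2 h3).mul_left hnM) hcop h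
  have hpm : (p : ℤ) ∣ m := hc ▸ (hpn.mul_left 3).mul_right _
  have hcop' : IsCoprime (2 * m - A) m := by
    have := hAm.neg_left.add_mul_right_left 2
    rwa [show -A + 2 * m = 2 * m - A by ring] at this
  -- With B = 3m - A, the element (2m - A) + mω is minus the conjugate of (A + Bω)/(1 - ω): the
  -- ramified prime has been divided out.
  have hnorm : (2 * m - A) ^ 2 - (2 * m - A) * m + m ^ 2 = A ^ 2 - 3 * A * m + 3 * m ^ 2 := by ring
  obtain ⟨x, y, hxy, hcases⟩ := eisenstein_eq_cube_of_prime hp hcop' (hnorm ▸ h3) (hnorm ▸ hd)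
  -- Now p ∣ m leaves only the unit 1, where m = 3xy(x - y).
  rcases hcases with ⟨ha, hb⟩ | ⟨ha, hb⟩ | ⟨ha, hb⟩
  · have hN : A ^ 2 - 3 * A * m + 3 * m ^ 2 = (x ^ 2 - x * y + y ^ 2) ^ 3 := by
      rw [← hnorm, ha, hb]; ring
    refine ⟨y, x - y, c, x ^ 2 - x * y + y ^ 2, ?_, by ring, hc, hN, ?_⟩
    · linarith
    · apply Int.cube_injective
      apply mul_left_cancel₀ (show 3 * n ≠ 0 by omega)
      rw [← h, hN]
      linear_combination (x ^ 2 - x * y + y ^ 2) ^ 3 * hc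
  · refine ((not_dvd_cubic_form hp (x := y) (y := x) fun h => hxy h.symm).1 ?_).elim
    convert hpm using 1
    rw [hb]; ring
  · refine ((not_dvd_cubic_form hp hxy).1 ?_).elim
    rw [hb] at hpm
    exact (dvd_neg).1 hpm

/-- Descent along the two `3`-isogenies: a primitive solution of `A ^ 3 + B ^ 3 = n C ^ 3` comes
from integers `l`, `k` for which `l k (l + k)` is `n` times a cube. -/
theorem exists_descent_of_cube_add_cube {n : ℤ} {p : ℕ} (hp : p = 2 ∨ p = 5) (hpn : (p : ℤ) ∣ n)
    (hn : n ∣ 100) {A B C : ℤ} (hAB : IsCoprime A B) (h : A ^ 3 + B ^ 3 = n * C ^ 3) :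
    ∃ l k c N : ℤ, l * k * (l + k) = n * c ^ 3 ∧
      ((l ^ 2 + l * k + k ^ 2 = 3 * N ∧ A + B = n * c ^ 3 ∧ A ^ 2 - A * B + B ^ 2 = N ^ 3 ∧
          C = c * N) ∨
        (l ^ 2 + l * k + k ^ 2 = N ∧ A + B = 9 * n * c ^ 3 ∧
          A ^ 2 - A * B + B ^ 2 = 3 * N ^ 3 ∧ C = 3 * c * N)) := by
  have hn0 : n ≠ 0 := by rintro rfl; omega
  have hM : (A + B) * (A ^ 2 - A * B + B ^ 2) = n * C ^ 3 := by rw [← h]; ring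
  have hcopM : IsCoprime n (A ^ 2 - A * B + B ^ 2) := by
    refine IsCoprime.of_isCoprime_of_dvd_left ?_ hn
    have h2 := Int.prime_two.coprime_iff_not_dvd.2 (not_dvd_sq_sub_mul_add_sq (Or.inl rfl) hAB)
    have h5 := (Nat.prime_iff_prime_int.1 Nat.prime_five).coprime_iff_not_dvd.2
      (not_dvd_sq_sub_mul_add_sq (Or.inr rfl) hAB)
    exact (h2.pow_left (m := 2)).mul_left (h5.pow_left (m := 2))
  by_cases h3 : 3 ∣ A ^ 2 - A * B + B ^ 2
  · obtain ⟨m, hm⟩ : 3 ∣ A + B := by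
      refine Int.prime_three.dvd_of_dvd_pow (n := 2) ?_
      rw [show (A + B) ^ 2 = A ^ 2 - A * B + B ^ 2 + 3 * (A * B) by ring]
      exact dvd_add h3 (dvd_mul_right _ _)
    obtain rfl : B = 3 * m - A := by linarith
    have hAm : IsCoprime A (3 * m) := by
      have := hAB.add_mul_left_right 1
      rwa [show 3 * m - A + A * 1 = 3 * m by ring] at this
    have hM3 : A ^ 2 - A * (3 * m - A) + (3 * m - A) ^ 2 = 3 * (A ^ 2 - 3 * A * m + 3 * m ^ 2) := by
      ring
    rw [hM3] at hcopM hM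
    have h3A : ¬ 3 ∣ A :=
      Int.prime_three.coprime_iff_not_dvd.1 hAm.of_mul_right_left.symm
    obtain ⟨C, rfl⟩ : 3 ∣ C := by
      refine Int.prime_three.dvd_of_dvd_pow (n := 3)
        (hcopM.of_mul_right_left.symm.dvd_of_dvd_mul_left ?_)
      rw [← hM]
      exact ⟨(A + (3 * m - A)) * (A ^ 2 - 3 * A * m + 3 * m ^ 2), by ring⟩
    obtain ⟨l, k, c, N, h1, h2, h3, h4, rfl⟩ := exists_descent_of_three_dvd hp hpn hn0
      hAm.of_mul_right_right h3A hcopM.of_mul_right_right (C := C) (by linarith)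
    exact ⟨l, k, c, N, h1, Or.inr ⟨h2, by linarith, by rw [hM3, h4], by ring⟩⟩
  · obtain ⟨l, k, c, N, h1, h2⟩ := exists_descent_of_not_three_dvd hp hpn hn0 hAB hcopM h3 hM
    exact ⟨l, k, c, N, h1, Or.inl h2⟩

end Descent

/-! ### The curves `y² + n y = x³` -/

open WeierstrassCurve

/-- The curve `y² + n y = x³`. -/
def cubicCurve {k : Type*} [Field k] (n : k) : WeierstrassCurve k := ⟨0, 0, n, 0, 0⟩

section Curve

variable {k : Type*} [Field k]

theorem cubicCurve_Δ (n : k) : (cubicCurve n).Δ = -27 * n ^ 4 := by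
  simp only [cubicCurve, WeierstrassCurve.Δ, WeierstrassCurve.b₂, WeierstrassCurve.b₄,
    WeierstrassCurve.b₆, WeierstrassCurve.b₈]
  ring

theorem cubicCurve_isElliptic [CharZero k] {n : k} (hn : n ≠ 0) : (cubicCurve n).IsElliptic := by
  refine ⟨?_⟩
  rw [cubicCurve_Δ]
  simp [hn]

theorem cubicCurve_equation_iff (n x y : k) :
    (cubicCurve n).toAffine.Equation x y ↔ y ^ 2 + n * y = x ^ 3 := by
  rw [Affine.equation_iff]
  simp [cubicCurve]

theorem cubicCurve_negY (n x y : k) : (cubicCurve n).toAffine.negY x y = -y - n := by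
  simp [cubicCurve, Affine.negY]

theorem cubicCurve_nonsingular_iff [CharZero k] {n : k} (hn : n ≠ 0) (x y : k) :
    (cubicCurve n).toAffine.Nonsingular x y ↔ y ^ 2 + n * y = x ^ 3 := by
  have := cubicCurve_isElliptic hn
  rw [← cubicCurve_equation_iff, Affine.equation_iff_nonsingular]

variable [DecidableEq k]

/-- The chord-tangent construction on `y² + n y = x³`, with the line of slope `l`. -/
theorem cubicCurve_add_eq_some {n x₁ y₁ x₂ y₂ : k}
    (h₁ : (cubicCurve n).toAffine.Nonsingular x₁ y₁)
    (h₂ : (cubicCurve n).toAffine.Nonsingular x₂ y₂)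
    (h : ¬(x₁ = x₂ ∧ y₁ = -y₂ - n)) :
    ∃ l x₃ y₃ : k, l * (x₁ - x₂) = y₁ - y₂ ∧
      (x₁ = x₂ → y₁ = y₂ ∧ 2 * y₁ + n ≠ 0 ∧ l * (2 * y₁ + n) = 3 * x₁ ^ 2) ∧
      x₃ = l ^ 2 - x₁ - x₂ ∧ y₃ = -(l * (x₃ - x₁) + y₁) - n ∧
      (∀ t, (l * (t - x₁) + y₁) ^ 2 + n * (l * (t - x₁) + y₁) - t ^ 3 =
        -((t - x₁) * (t - x₂) * (t - x₃))) ∧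
      ∃ h₃, Affine.Point.some x₁ y₁ h₁ + Affine.Point.some x₂ y₂ h₂ =
        Affine.Point.some x₃ y₃ h₃ := by
  have hxy : ¬(x₁ = x₂ ∧ y₁ = (cubicCurve n).toAffine.negY x₂ y₂) := by
    rwa [cubicCurve_negY]
  refine ⟨(cubicCurve n).toAffine.slope x₁ x₂ y₁ y₂, _, _, ?_, fun hx => ?_, rfl, rfl, fun t => ?_,
    ?_⟩
  · by_cases hx : x₁ = x₂
    · have := Affine.Y_eq_of_Y_ne h₁.1 h₂.1 hx fun hy => hxy ⟨hx, hy⟩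
      simp [hx, this]
    · rw [Affine.slope_of_X_ne hx, div_mul_cancel₀ _ (sub_ne_zero.2 hx)]
  · have hy := Affine.Y_eq_of_Y_ne h₁.1 h₂.1 hx fun hy => hxy ⟨hx, hy⟩
    have h2 : 2 * y₁ + n ≠ 0 := fun h0 => h ⟨hx, by rw [← hy]; linear_combination h0⟩
    refine ⟨hy, h2, ?_⟩
    rw [Affine.slope_of_Y_ne hx fun hy => hxy ⟨hx, hy⟩, cubicCurve_negY]
    have : y₁ - (-y₁ - n) ≠ 0 := by convert h2 using 1; ring
    simp only [cubicCurve]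
    field_simp
    ring
  · have := congrArg (Polynomial.eval t) (Affine.addPolynomial_slope h₁.1 h₂.1 hxy)
    rw [Affine.addPolynomial_eq] at this
    generalize (cubicCurve n).toAffine.slope x₁ x₂ y₁ y₂ = l at this ⊢
    simp only [Cubic.toPoly, cubicCurve, Affine.addX] at this
    simp only [Polynomial.eval_neg, Polynomial.eval_add, Polynomial.eval_mul, Polynomial.eval_C,
      Polynomial.eval_pow, Polynomial.eval_X, Polynomial.eval_sub] at this
    linear_combination this
  · have e₁ : (cubicCurve n).toAffine.addX x₁ x₂ ((cubicCurve n).toAffine.slope x₁ x₂ y₁ y₂) =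
        (cubicCurve n).toAffine.slope x₁ x₂ y₁ y₂ ^ 2 - x₁ - x₂ := by
      simp [Affine.addX, cubicCurve]
    have e₂ : (cubicCurve n).toAffine.addY x₁ x₂ y₁ ((cubicCurve n).toAffine.slope x₁ x₂ y₁ y₂) =
        -((cubicCurve n).toAffine.slope x₁ x₂ y₁ y₂ * (((cubicCurve n).toAffine.slope x₁ x₂ y₁ y₂ ^ 2
          - x₁ - x₂) - x₁) + y₁) - n := by
      rw [Affine.addY, cubicCurve_negY, Affine.negAddY, e₁]
    have := Affine.nonsingular_add h₁ h₂ hxy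
    rw [e₁, e₂] at this
    refine ⟨this, ?_⟩
    rw [Affine.Point.add_some hxy]
    simp only [e₁, e₂]

/-- The `x`-coordinate of `3 R` on `y² + n y = x³`. -/
theorem cubicCurve_three_nsmul [CharZero k] {n x y : k}
    (h : (cubicCurve n).toAffine.Nonsingular x y) (hx : x ≠ 0) (hxn : x ^ 3 + n ^ 2 ≠ 0) :
    ∃ x' y' h', 3 • Affine.Point.some x y h = Affine.Point.some x' y' h' ∧
      x' * (9 * x ^ 2 * (x ^ 3 + n ^ 2) ^ 2) = (x ^ 3 + n ^ 2) ^ 3 - 27 * n ^ 2 * x ^ 6 := by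
  have he := (cubicCurve_equation_iff n x y).1 h.1
  have h3 : 3 • Affine.Point.some x y h =
      (Affine.Point.some x y h + Affine.Point.some x y h) + Affine.Point.some x y h := by
    rw [succ_nsmul, two_nsmul]
  rw [h3]
  -- At a 2-torsion point the tangent is vertical and 3R = R.
  by_cases hy : y = -y - n
  · refine ⟨x, y, h, ?_, ?_⟩
    · rw [Affine.Point.add_of_Y_eq rfl (by rwa [cubicCurve_negY]), zero_add]
    · have : n = -2 * y := by linear_combination hy
      subst this
      have : x ^ 3 = - y ^ 2 := by rw [← he]; ring
      have h6 : x ^ 6 = y ^ 4 := by rw [show x ^ 6 = (x ^ 3) ^ 2 by ring, this]; ring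
      rw [show x * (9 * x ^ 2 * (x ^ 3 + (-2 * y) ^ 2) ^ 2) =
        9 * x ^ 3 * (x ^ 3 + (-2 * y) ^ 2) ^ 2 by ring, h6, this]
      ring
  · obtain ⟨l, x₂, y₂, -, h1, hx₂, hy₂, -, h₂, e₂⟩ :=
      cubicCurve_add_eq_some h h (fun h' => hy h'.2)
    obtain ⟨-, hd, hl⟩ := h1 rfl
    rw [e₂]
    have hd2 : (2 * y + n) ^ 2 = 4 * x ^ 3 + n ^ 2 := by linear_combination 4 * he
    have hx2x : (x₂ - x) * (2 * y + n) ^ 2 = -3 * x * (x ^ 3 + n ^ 2) := by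
      rw [hx₂]
      linear_combination (l * (2 * y + n) + 3 * x ^ 2) * hl - 3 * x * hd2
    -- If 2R and R had the same abscissa, the 3-division polynomial 3x(x³ + n²) would vanish.
    have hne : x₂ - x ≠ 0 := by
      intro h0
      rw [h0, zero_mul] at hx2x
      have : x * (x ^ 3 + n ^ 2) = 0 := by linear_combination (1 / 3) * hx2x
      exact (mul_ne_zero hx hxn) this
    obtain ⟨l', x₃, y₃, hl₃, -, hx₃, -, -, h₃, e₃⟩ :=
      cubicCurve_add_eq_some h₂ h (fun h' => hne (sub_eq_zero.2 h'.1))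
    refine ⟨x₃, y₃, h₃, e₃, ?_⟩
    have hl'' : l' * (3 * x * (x ^ 3 + n ^ 2)) =
        (2 * y + n) ^ 3 - 3 * l * x * (x ^ 3 + n ^ 2) := by
      rw [hy₂] at hl₃
      linear_combination -(2 * y + n) ^ 2 * hl₃ + (l' + l) * hx2x
    have e : x₃ * (9 * x ^ 2 * (x ^ 3 + n ^ 2) ^ 2) =
        (l' * (3 * x * (x ^ 3 + n ^ 2))) ^ 2 - (x₂ + x) * (9 * x ^ 2 * (x ^ 3 + n ^ 2) ^ 2) := by
      rw [hx₃]; ring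
    have e' : x₃ * (9 * x ^ 2 * (x ^ 3 + n ^ 2) ^ 2) = ((2 * y + n) ^ 2) ^ 3 -
        6 * (l * (2 * y + n)) * (2 * y + n) ^ 2 * x * (x ^ 3 + n ^ 2) +
        9 * x ^ 3 * (x ^ 3 + n ^ 2) ^ 2 := by
      rw [e, hl'', hx₂]; ring
    rw [e', hl, hd2]
    ring

end Curve

/-! ### The descent map of the `3`-isogeny -/

section DescentMap

variable (p : ℕ) [Fact p.Prime]

/-- The `p`-adic valuation modulo `3`. -/
def valModThree (x : ℚ) : ZMod 3 := (padicValRat p x : ZMod 3)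

variable {p}

theorem valModThree_mul {x y : ℚ} (hx : x ≠ 0) (hy : y ≠ 0) :
    valModThree p (x * y) = valModThree p x + valModThree p y := by
  rw [valModThree, padicValRat.mul hx hy, Int.cast_add]; rfl

theorem valModThree_neg {q : ℕ} (x : ℚ) : valModThree q (-x) = valModThree q x := by
  rw [valModThree, padicValRat.neg]; rfl

theorem valModThree_cube (x : ℚ) : valModThree p (x ^ 3) = 0 := by
  rw [valModThree, padicValRat.pow, Int.cast_mul]
  exact mul_eq_zero_of_left (by decide) _

variable (p) in
/-- The class of a point of `y² + n y = x³` with ordinate `y`. -/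
def ordinateClass (n y : ℚ) : ZMod 3 := if y = 0 then -valModThree p n else valModThree p y

/-- Since y(y + n) = x³, the classes of y and y + n modulo cubes are inverse to each other. This
dictates the value -v_p(n) at y = 0, where v_p(y) carries no information. -/
theorem ordinateClass_eq_neg {n x y : ℚ} (h : y ^ 2 + n * y = x ^ 3) (hy : y + n ≠ 0) :
    ordinateClass p n y = -valModThree p (y + n) := by
  rw [ordinateClass]
  split_ifs with h0
  · rw [h0, zero_add]
  · rw [eq_neg_iff_add_eq_zero, ← valModThree_mul h0 hy, ← valModThree_cube (p := p) x, ← h]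
    ring_nf

theorem ordinateClass_neg {n x y : ℚ} (hn : n ≠ 0) (h : y ^ 2 + n * y = x ^ 3) :
    ordinateClass p n (-y - n) = -ordinateClass p n y := by
  by_cases hy : y + n = 0
  · have : y ≠ 0 := by rintro rfl; exact hn (by linarith)
    rw [show -y - n = 0 by linarith, ordinateClass, if_pos rfl, ordinateClass, if_neg this,
      show y = -n by linarith, valModThree_neg]
  · rw [ordinateClass_eq_neg h hy, neg_neg, ordinateClass, if_neg (by contrapose! hy; linarith),
      show -y - n = -(y + n) by ring, valModThree_neg]

/-- On the line y = lx + m one has y₁y₂y₃ = m³ and ∏(yᵢ + n) = (m + n)³, so either product yields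
the relation when its factors are nonzero. If both have a zero factor, the line contains (0, 0) and
(0, -n), which a non-vertical line cannot. -/
theorem ordinateClass_add_of_collinear {n l m x₁ x₂ x₃ y₁ y₂ y₃ : ℚ} (hn : n ≠ 0)
    (e₁ : y₁ ^ 2 + n * y₁ = x₁ ^ 3) (e₂ : y₂ ^ 2 + n * y₂ = x₂ ^ 3) (e₃ : y₃ ^ 2 + n * y₃ = x₃ ^ 3)
    (h₁ : y₁ = l * x₁ + m) (h₂ : y₂ = l * x₂ + m) (h₃ : y₃ = l * x₃ + m)
    (h : ∀ t, (l * t + m) ^ 2 + n * (l * t + m) - t ^ 3 = -((t - x₁) * (t - x₂) * (t - x₃))) :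
    ordinateClass p n y₁ + ordinateClass p n y₂ + ordinateClass p n y₃ = 0 := by
  -- Evaluate the factored cubic where the line has ordinate -a; y² + ny vanishes there for a = 0
  -- and a = n.
  have hprod (a : ℚ) (ha : a * (a - n) = 0) : (y₁ + a) * (y₂ + a) * (y₃ + a) = (m + a) ^ 3 := by
    by_cases hl : l = 0
    · subst hl
      rw [h₁, h₂, h₃]; ring
    · have h' : m + l * (-(m + a) / l) = -a := by field_simp; ring
      have := h (-(m + a) / l)
      rw [show l * (-(m + a) / l) + m = -a by rw [← h']; ring] at this
      rw [h₁, h₂, h₃]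
      field_simp at this
      linear_combination -this + l ^ 3 * ha
  have h0 {x y : ℚ} (e : y ^ 2 + n * y = x ^ 3) (hy : y * (y + n) = 0) : x = 0 := by
    refine pow_eq_zero_iff (n := 3) (by norm_num) |>.1 ?_
    rw [← e, ← hy]; ring
  by_cases hA : y₁ ≠ 0 ∧ y₂ ≠ 0 ∧ y₃ ≠ 0
  · obtain ⟨a, b, c⟩ := hA
    rw [ordinateClass, ordinateClass, ordinateClass, if_neg a, if_neg b, if_neg c,
      ← valModThree_mul a b, ← valModThree_mul (mul_ne_zero a b) c, ← valModThree_cube (p := p) m]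
    have := hprod 0 (by ring)
    simp only [add_zero] at this
    rw [this]
  by_cases hB : y₁ + n ≠ 0 ∧ y₂ + n ≠ 0 ∧ y₃ + n ≠ 0
  · obtain ⟨a, b, c⟩ := hB
    rw [ordinateClass_eq_neg e₁ a, ordinateClass_eq_neg e₂ b, ordinateClass_eq_neg e₃ c,
      ← neg_add, ← neg_add, ← valModThree_mul a b, ← valModThree_mul (mul_ne_zero a b) c,
      hprod n (by ring), valModThree_cube, neg_zero]
  · exfalso
    have hm : m = 0 := by
      have : y₁ = 0 ∨ y₂ = 0 ∨ y₃ = 0 := by tauto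
      rcases this with h | h | h
      · rw [h0 e₁ (by simp [h])] at h₁; linarith
      · rw [h0 e₂ (by simp [h])] at h₂; linarith
      · rw [h0 e₃ (by simp [h])] at h₃; linarith
    have hm' : m = -n := by
      have : y₁ + n = 0 ∨ y₂ + n = 0 ∨ y₃ + n = 0 := by tauto
      rcases this with h | h | h
      · rw [h0 e₁ (by simp [h])] at h₁; linarith
      · rw [h0 e₂ (by simp [h])] at h₂; linarith
      · rw [h0 e₃ (by simp [h])] at h₃; linarith
    exact hn (by linarith)

variable (p) in
/-- The descent map `(x, y) ↦ v_p(y) mod 3` on the points of `y² + n y = x³`. -/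
def descentFun (n : ℚ) : (cubicCurve n).toAffine.Point → ZMod 3
  | .zero => 0
  | .some _ y _ => ordinateClass p n y

variable (p) in
/-- The descent map `(x, y) ↦ v_p(y) mod 3` as a homomorphism. -/
def descentHom {n : ℚ} (hn : n ≠ 0) : (cubicCurve n).toAffine.Point →+ ZMod 3 :=
  AddMonoidHom.mk' (descentFun p n) fun P Q => by
    rcases P with _ | ⟨x₁, y₁, h₁⟩
    · change descentFun p n (0 + Q) = 0 + _
      rw [zero_add, zero_add]
    rcases Q with _ | ⟨x₂, y₂, h₂⟩
    · change descentFun p n (_ + 0) = _ + 0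
      rw [add_zero, add_zero]
    have e₁ := (cubicCurve_equation_iff n x₁ y₁).1 h₁.1
    have e₂ := (cubicCurve_equation_iff n x₂ y₂).1 h₂.1
    by_cases h : x₁ = x₂ ∧ y₁ = -y₂ - n
    · rw [Affine.Point.add_of_Y_eq h.1 (by rw [cubicCurve_negY]; exact h.2)]
      change 0 = ordinateClass p n y₁ + ordinateClass p n y₂
      rw [h.2, ordinateClass_neg hn e₂, neg_add_cancel]
    · obtain ⟨l, x₃, y₃, hl, -, -, hy₃, ht, h₃, e⟩ := cubicCurve_add_eq_some h₁ h₂ h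
      have e₃ := (cubicCurve_equation_iff n x₃ y₃).1 h₃.1
      rw [e]
      change ordinateClass p n y₃ = ordinateClass p n y₁ + ordinateClass p n y₂
      have e₃' : (-y₃ - n) ^ 2 + n * (-y₃ - n) = x₃ ^ 3 := by rw [← e₃]; ring
      have := ordinateClass_add_of_collinear (p := p) (l := l) (m := y₁ - l * x₁) hn e₁ e₂ e₃'
        (by ring) (by linear_combination hl) (by rw [hy₃]; ring)
        (fun t => by rw [← ht t]; ring)
      rw [ordinateClass_neg hn e₃] at this
      linear_combination -this

theorem descentHom_some {n x y : ℚ} (hn : n ≠ 0) (h) :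
    descentHom p hn (.some x y h) = ordinateClass p n y := rfl

/-- The valuations of y and y + n add up to 3v(x). When v(n) = 0 they are equal if v(y) < 0, and v(y
+ n) = 0 if v(y) > 0. -/
theorem three_dvd_padicValRat {n x y : ℚ} (hn : n ≠ 0) (hpn : padicValRat p n = 0)
    (h : y ^ 2 + n * y = x ^ 3) : 3 ∣ padicValRat p y := by
  by_cases hy : y = 0
  · simp [hy]
  by_cases hyn : y + n = 0
  · rw [show y = -n by linarith, padicValRat.neg, hpn]; exact dvd_zero _
  have h3 : padicValRat p y + padicValRat p (y + n) = 3 * padicValRat p x := by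
    rw [← padicValRat.mul hy hyn, show y * (y + n) = x ^ 3 by rw [← h]; ring, padicValRat.pow]
    rfl
  rcases lt_trichotomy (padicValRat p y) 0 with h0 | h0 | h0
  · rw [padicValRat.add_eq_of_lt hyn hy hn (by rwa [hpn])] at h3
    omega
  · rw [h0]; exact dvd_zero _
  · rw [add_comm y n] at h3 hyn
    rw [padicValRat.add_eq_of_lt hyn hn hy (by rwa [hpn]), hpn] at h3
    omega

end DescentMap

/-! ### Cubes detected by valuations. -/

theorem Nat.exists_eq_cube {m : ℕ} (h : ∀ p, p.Prime → 3 ∣ padicValNat p m) : ∃ c, m = c ^ 3 := by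
  rcases eq_or_ne m 0 with rfl | hm
  · exact ⟨0, rfl⟩
  refine ⟨m.factorization.prod fun p e => p ^ (e / 3), ?_⟩
  conv_lhs => rw [← Nat.prod_factorization_pow_eq_self hm]
  rw [Finsupp.prod, Finsupp.prod, ← Finset.prod_pow]
  refine Finset.prod_congr rfl fun p hp => ?_
  have hp' := Nat.prime_of_mem_primeFactors hp
  rw [← pow_mul, Nat.div_mul_cancel (Nat.factorization_def m hp' ▸ h p hp')]

theorem Rat.exists_eq_cube {y : ℚ} (h : ∀ p, p.Prime → 3 ∣ padicValRat p y) : ∃ s : ℚ, y = s ^ 3 := by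
  have key (p : ℕ) (hp : p.Prime) : 3 ∣ padicValNat p y.num.natAbs ∧ 3 ∣ padicValNat p y.den := by
    have := h p hp
    rw [padicValRat] at this
    have hcop := y.reduced
    have : padicValNat p y.num.natAbs = 0 ∨ padicValNat p y.den = 0 := by
      by_contra! hne
      have h1 := dvd_of_one_le_padicValNat (Nat.one_le_iff_ne_zero.2 hne.1)
      have h2 := dvd_of_one_le_padicValNat (Nat.one_le_iff_ne_zero.2 hne.2)
      exact hp.one_lt.ne' (Nat.dvd_one.1 (hcop ▸ Nat.dvd_gcd h1 h2))
    rw [padicValInt] at *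
    omega
  obtain ⟨a, ha⟩ := Nat.exists_eq_cube fun p hp => (key p hp).1
  obtain ⟨b, hb⟩ := Nat.exists_eq_cube fun p hp => (key p hp).2
  have hy : y = y.num / (b : ℚ) ^ 3 := by
    rw [← Nat.cast_pow, ← hb, Rat.num_div_den]
  rcases Int.natAbs_eq y.num with h | h
  · refine ⟨a / b, ?_⟩
    rw [hy, h, ha]; push_cast; rw [div_pow]
  · refine ⟨-a / b, ?_⟩
    rw [hy, h, ha]; push_cast; rw [div_pow]; ring

/-! ### The kernel of the descent maps -/

/-- As n is an integer, the denominator of s also clears t. As n is cube-free, a common prime of the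
numerators would divide that denominator, against lowest terms. -/
theorem exists_coprime_cube_add_cube {n : ℤ} (hn : n ∣ 100) {s t : ℚ} (h : t ^ 3 = s ^ 3 + n) :
    ∃ A B C : ℤ, C ≠ 0 ∧ IsCoprime A B ∧ A ^ 3 + B ^ 3 = n * C ^ 3 ∧ s = -A / C ∧ t = B / C := by
  have hC : (s.den : ℚ) ≠ 0 := by exact_mod_cast s.den_ne_zero
  have hs : s = s.num / s.den := (Rat.num_div_den s).symm
  have hB3 : (t * s.den) ^ 3 = ((s.num ^ 3 + n * s.den ^ 3 : ℤ) : ℚ) := by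
    rw [mul_pow, h]
    push_cast
    rw [add_mul, ← mul_pow, show s * s.den = s.num from Rat.mul_den_eq_num s]
  have hden : (t * s.den).den = 1 := by
    have := congrArg Rat.den hB3
    rw [Rat.den_pow, Rat.den_intCast] at this
    exact (Nat.pow_eq_one.1 this).resolve_right (by norm_num)
  have hB : t * s.den = ((t * s.den).num : ℚ) := ((Rat.den_eq_one_iff _).1 hden).symm
  set B : ℤ := (t * s.den).num
  have heq : (-s.num) ^ 3 + B ^ 3 = n * (s.den : ℤ) ^ 3 := by
    rw [hB] at hB3
    have : B ^ 3 = s.num ^ 3 + n * (s.den : ℤ) ^ 3 := by exact_mod_cast hB3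
    rw [this]; ring
  refine ⟨-s.num, B, s.den, by exact_mod_cast hC, ?_, heq, ?_, ?_⟩
  · refine isCoprime_of_prime_dvd ?_ fun q hq hqA hqB => ?_
    · rintro ⟨h1, h2⟩
      rw [h1, h2] at heq
      have hn0 : n ≠ 0 := by rintro rfl; omega
      have : n * (s.den : ℤ) ^ 3 ≠ 0 := mul_ne_zero hn0 (pow_ne_zero 3 (by exact_mod_cast hC))
      exact this (by rw [← heq]; ring)
    · have hq3 : q ^ 3 ∣ n * (s.den : ℤ) ^ 3 :=
        heq ▸ dvd_add (pow_dvd_pow_of_dvd hqA 3) (pow_dvd_pow_of_dvd hqB 3)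
      have hcop : IsCoprime q (s.den : ℤ) := by
        have : IsCoprime (-s.num) (s.den : ℤ) :=
          (Int.isCoprime_iff_gcd_eq_one.2 (by simpa [Int.gcd] using s.reduced)).neg_left
        exact this.of_isCoprime_of_dvd_left hqA
      have h100 : q ^ 3 ∣ 100 := ((hcop.pow (m := 3) (n := 3)).dvd_of_dvd_mul_right hq3).trans hn
      have h100' : q.natAbs ^ 3 ∣ 100 := by
        rw [← Int.natAbs_pow]; exact Int.natAbs_dvd_natAbs.2 h100
      have h2 := (Int.prime_iff_natAbs_prime.1 hq).two_le
      have h5 : q.natAbs < 5 := by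
        by_contra! h5
        have := Nat.le_of_dvd (by norm_num) h100'
        have : 5 ^ 3 ≤ q.natAbs ^ 3 := Nat.pow_le_pow_left h5 3
        omega
      generalize q.natAbs = r at *
      interval_cases r <;> omega
  · push_cast
    rw [neg_neg]; exact hs
  · push_cast
    rw [← hB, mul_div_cancel_right₀ _ hC]

/-- A point whose ordinates `y` and `y + n` are both cubes is divisible by `3`. -/
theorem exists_three_nsmul_eq_of_cube {n : ℤ} (hn : n ∣ 100) {p : ℕ} (hp : p = 2 ∨ p = 5)
    (hpn : (p : ℤ) ∣ n) {s t x y : ℚ} (hy : y = s ^ 3) (hyn : y + n = t ^ 3)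
    (h : (cubicCurve (n : ℚ)).toAffine.Nonsingular x y) :
    ∃ R, 3 • R = Affine.Point.some x y h := by
  have hn0 : (n : ℚ) ≠ 0 := by
    rintro h0
    rw [Int.cast_eq_zero] at h0
    subst h0
    omega
  have hx : x = s * t := by
    apply (Odd.strictMono_pow (n := 3) (by decide)).injective
    have := (cubicCurve_equation_iff _ x y).1 h.1
    simp only
    rw [← this, mul_pow, ← hy, ← hyn]; ring
  obtain ⟨A, B, C, hC, hAB, hABC, hs, ht⟩ := exists_coprime_cube_add_cube hn
    (s := s) (t := t) (by rw [← hyn, hy])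
  obtain ⟨l, k, c, N, h1, h2⟩ := exists_descent_of_cube_add_cube hp hpn hn hAB hABC
  -- Both descent cases put x = st = -AB/C² in the shape (X³ - 27n²)/(9X²) with X = Q/c², the second
  -- half of the tripling formula.
  obtain ⟨Q, hQ, hc, hQ0, hxQ⟩ : ∃ Q : ℚ, Q = l ^ 2 + l * k + k ^ 2 ∧ c ≠ 0 ∧ Q ≠ 0 ∧
      x * (9 * Q ^ 2 * c ^ 2) = Q ^ 3 - 27 * n ^ 2 * c ^ 6 := by
    refine ⟨l ^ 2 + l * k + k ^ 2, rfl, ?_⟩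
    have hCQ : (C : ℚ) ≠ 0 := by exact_mod_cast hC
    have hxC : x * C ^ 2 = -(A * B) := by rw [hx, hs, ht]; field_simp
    rcases h2 with ⟨h2, h3, h4, rfl⟩ | ⟨h2, h3, h4, rfl⟩
    · have hc : c ≠ 0 := by rintro rfl; simp at hC
      have hN : N ≠ 0 := by rintro rfl; simp at hC
      have e2 : (l ^ 2 + l * k + k ^ 2 : ℚ) = 3 * N := by exact_mod_cast h2
      have e3 : (A + B : ℚ) = n * c ^ 3 := by exact_mod_cast h3
      have e4 : (A ^ 2 - A * B + B ^ 2 : ℚ) = N ^ 3 := by exact_mod_cast h4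
      refine ⟨hc, by rw [e2]; positivity, ?_⟩
      rw [e2]
      push_cast at hxC
      linear_combination 81 * hxC + 27 * e4 - 27 * (A + B + n * c ^ 3) * e3
    · have hc : c ≠ 0 := by rintro rfl; simp at hC
      have hN : N ≠ 0 := by rintro rfl; simp at hC
      have e2 : (l ^ 2 + l * k + k ^ 2 : ℚ) = N := by exact_mod_cast h2
      have e3 : (A + B : ℚ) = 9 * n * c ^ 3 := by exact_mod_cast h3
      have e4 : (A ^ 2 - A * B + B ^ 2 : ℚ) = 3 * N ^ 3 := by exact_mod_cast h4
      refine ⟨hc, by rw [e2]; positivity, ?_⟩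
      rw [e2]
      push_cast at hxC
      linear_combination hxC + (1 / 3) * e4 - (1 / 3) * (A + B + 9 * n * c ^ 3) * e3
  have hcQ : (c : ℚ) ≠ 0 := by exact_mod_cast hc
  have h1' : (l * k * (l + k) : ℚ) = n * c ^ 3 := by exact_mod_cast h1
  have hlk : (l + k : ℚ) ≠ 0 := by
    intro h0
    rw [h0, mul_zero] at h1'
    exact mul_ne_zero hn0 (pow_ne_zero 3 hcQ) h1'.symm
  -- This is the point R: the relation l k (l + k) = n c³ is the curve equation in the coordinates x
  -- = -nc/(l + k), y = -nl/(l + k).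
  have hR : (-(n * l) / (l + k) : ℚ) ^ 2 + n * (-(n * l) / (l + k)) = (-(n * c) / (l + k)) ^ 3 := by
    field_simp
    linear_combination -h1'
  have hsum : (-(n * c) / (l + k) : ℚ) ^ 3 + n ^ 2 = (-(n * c) / (l + k)) ^ 2 * (Q / c ^ 2) := by
    rw [hQ]
    field_simp
    linear_combination h1'
  have hx0 : (-(n * c) / (l + k) : ℚ) ≠ 0 := by
    rw [neg_div, neg_ne_zero]; positivity
  generalize (-(n * c) / (l + k) : ℚ) = u at hR hsum hx0
  obtain ⟨x', y', h', e, hx'⟩ := cubicCurve_three_nsmul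
    ((cubicCurve_nonsingular_iff hn0 _ _).2 hR) hx0
    (by rw [hsum]; positivity)
  have hxx' : x' = x := by
    rw [hsum] at hx'
    field_simp at hx' hxQ
    apply mul_right_cancel₀ (show 9 * Q ^ 2 * (c : ℚ) ^ 2 ≠ 0 by positivity)
    linear_combination hx' - hxQ
  -- Equal abscissas determine 3R only up to sign; replace R by -R if needed.
  rcases Affine.Point.X_eq_iff (h₁ := h') (h₂ := h) |>.1 hxx' with h3 | h3
  · exact ⟨_, e.trans h3⟩
  · refine ⟨-Affine.Point.some _ _ ((cubicCurve_nonsingular_iff hn0 _ _).2 hR), ?_⟩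
    rw [neg_nsmul, e, h3, neg_neg]

theorem padicValRat_intCast_eq_zero {q : ℕ} [Fact q.Prime] {n : ℤ} (h : ¬ (q : ℤ) ∣ n) :
    padicValRat q (n : ℚ) = 0 := by
  rw [padicValRat.of_int, padicValInt.eq_zero_of_not_dvd h]; rfl

instance fact_prime_five : Fact (Nat.Prime 5) := ⟨Nat.prime_five⟩

/-- The common kernel of the two descent maps consists of multiples of `3`. -/
theorem exists_three_nsmul_eq {n : ℤ} (hn : n ∣ 100) {p : ℕ} [Fact p.Prime] (hp : p = 2 ∨ p = 5)
    (hpn : (p : ℤ) ∣ n) (hv : valModThree p n ≠ 0) (hn0 : (n : ℚ) ≠ 0)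
    (P : (cubicCurve (n : ℚ)).toAffine.Point)
    (h2 : descentHom 2 hn0 P = 0) (h5 : descentHom 5 hn0 P = 0) : ∃ R, 3 • R = P := by
  rcases P with _ | ⟨x, y, h⟩
  · exact ⟨0, nsmul_zero _⟩
  have e := (cubicCurve_equation_iff _ x y).1 h.1
  rw [descentHom_some] at h2 h5
  have hp' : ordinateClass p n y = 0 := by rcases hp with rfl | rfl <;> assumption
  have hy : y ≠ 0 := by
    rintro rfl
    rw [ordinateClass, if_pos rfl, neg_eq_zero] at hp'
    exact hv hp'
  have hyn : y + n ≠ 0 := by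
    intro h0
    rw [show y = -n by linarith, ordinateClass, if_neg (neg_ne_zero.2 hn0), valModThree_neg] at hp'
    exact hv hp'
  obtain ⟨s, hs⟩ := Rat.exists_eq_cube (y := y) fun q hq => by
    have := Fact.mk hq
    by_cases hq2 : q = 2
    · subst hq2
      rw [ordinateClass, if_neg hy, valModThree] at h2
      exact_mod_cast (ZMod.intCast_zmod_eq_zero_iff_dvd _ 3).1 h2
    by_cases hq5 : q = 5
    · subst hq5
      rw [ordinateClass, if_neg hy, valModThree] at h5
      exact_mod_cast (ZMod.intCast_zmod_eq_zero_iff_dvd _ 3).1 h5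
    refine three_dvd_padicValRat hn0 (padicValRat_intCast_eq_zero fun hqn => ?_) e
    have h100 : q ∣ 2 ^ 2 * 5 ^ 2 := by exact_mod_cast hqn.trans hn
    rcases (Nat.Prime.dvd_mul hq).1 h100 with h | h
    · exact hq2 ((Nat.prime_dvd_prime_iff_eq hq Nat.prime_two).1 (hq.dvd_of_dvd_pow h))
    · exact hq5 ((Nat.prime_dvd_prime_iff_eq hq Nat.prime_five).1 (hq.dvd_of_dvd_pow h))
  have hs0 : s ≠ 0 := by rintro rfl; exact hy (by rw [hs]; norm_num)
  refine exists_three_nsmul_eq_of_cube hn hp hpn (s := s) (t := x / s) hs ?_ h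
  rw [div_pow, ← hs, ← e]
  field_simp

/-! ### Heights and finite generation -/

open Height

/-- The map u ↦ (u³ + a)/(bu²) has degree 3. Its shape covers the effect of both 3-isogenies on
abscissas. -/
theorem exists_three_mul_logHeight₁_le {a b : ℚ} (ha : a ≠ 0) (hb : b ≠ 0) :
    ∃ C : ℝ, ∀ u : ℚ, u ≠ 0 → 3 * logHeight₁ u ≤ logHeight₁ ((u ^ 3 + a) / (b * u ^ 2)) + C := by
  let X : MvPolynomial (Fin 2) ℚ := .X 0
  let Y : MvPolynomial (Fin 2) ℚ := .X 1
  -- A Nullstellensatz certificate: these quadratic forms combine X³ + aY³ and bX²Y to X⁵ and to Y⁵.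
  let q : Fin 2 × Fin 2 → MvPolynomial (Fin 2) ℚ := fun ij =>
    ![![X ^ 2, .C (-a / b) * Y ^ 2], ![.C (1 / a) * Y ^ 2, .C (-1 / (a * b)) * (X * Y)]] ij.1 ij.2
  have hq (ij) : (q ij).IsHomogeneous 2 := by
    have hX : X.IsHomogeneous 1 := MvPolynomial.isHomogeneous_X _ _
    have hY : Y.IsHomogeneous 1 := MvPolynomial.isHomogeneous_X _ _
    obtain ⟨i, j⟩ := ij
    fin_cases i <;> fin_cases j
    · exact hX.pow 2
    · exact (hY.pow 2).C_mul _
    · exact (hY.pow 2).C_mul _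
    · exact (hX.mul hY).C_mul _
  obtain ⟨C, hC⟩ := logHeight_eval_ge' (N := 3) hq
  refine ⟨-C, fun u hu => ?_⟩
  have := hC ![X ^ 3 + .C a * Y ^ 3, .C b * (X ^ 2 * Y)] (x := ![u, 1]) (fun k => by
    fin_cases k
    · simp [q, X, Y, Fin.sum_univ_two]
      field_simp
      ring
    · simp [q, X, Y, Fin.sum_univ_two]
      field_simp
      ring)
  rw [← logHeight₁_eq_logHeight] at this
  rw [logHeight₁_div_eq_logHeight]
  have e : (fun j => (MvPolynomial.eval ![u, 1]) ((![X ^ 3 + .C a * Y ^ 3, .C b * (X ^ 2 * Y)] :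
      Fin 2 → MvPolynomial (Fin 2) ℚ) j)) = ![u ^ 3 + a, b * u ^ 2] := by
    funext j
    fin_cases j <;> simp [X, Y]
  rw [e] at this
  push_cast at this
  linarith

section

variable {n : ℚ}

/-- The naive height: the logarithmic height of the `x`-coordinate. -/
noncomputable def xHeight : (cubicCurve n).toAffine.Point → ℝ
  | .zero => 0
  | .some x _ _ => logHeight₁ x

theorem xHeight_zero : xHeight (0 : (cubicCurve n).toAffine.Point) = 0 := rfl

theorem xHeight_some {x y : ℚ} (h : (cubicCurve n).toAffine.Nonsingular x y) :
    xHeight (.some x y h) = logHeight₁ x := rfl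

theorem xHeight_nonneg (P : (cubicCurve n).toAffine.Point) : 0 ≤ xHeight P := by
  rcases P with _ | ⟨x, y, h⟩
  · exact le_rfl
  · exact zero_le_logHeight₁ x

instance northcott_xHeight : Northcott (xHeight (n := n)) where
  finite_le B := by
    have hfin := NumberField.finite_setOfPred_logHeight₁_le ℚ B
    refine Set.Finite.subset (s := {0} ∪ ⋃ x ∈ {x : ℚ | logHeight₁ x ≤ B},
      {P | ∃ y h, P = Affine.Point.some x y h}) ?_ ?_
    · refine (Set.finite_singleton _).union (hfin.biUnion fun x _ => ?_)
      by_cases hx : ∃ y, (cubicCurve n).toAffine.Nonsingular x y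
      · obtain ⟨y, h⟩ := hx
        refine Set.Finite.subset (s := {Affine.Point.some x y h, -Affine.Point.some x y h})
          (Set.toFinite _) ?_
        rintro _ ⟨y', h', rfl⟩
        exact Affine.Point.X_eq_iff.1 rfl
      · convert Set.finite_empty
        rw [Set.eq_empty_iff_forall_notMem]
        rintro _ ⟨y, h, rfl⟩
        exact hx ⟨y, h⟩
    · rintro (_ | ⟨x, y, h⟩) hP
      · exact Or.inl rfl
      · exact Or.inr (Set.mem_biUnion (x := x) hP ⟨y, h, rfl⟩)

/-- Complete the square: (y + n/2)² = x³ + n²/4. -/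
theorem exists_logHeight₁_ordinate_le (n : ℚ) :
    ∃ C : ℝ, ∀ x y : ℚ, y ^ 2 + n * y = x ^ 3 → 2 * logHeight₁ y ≤ 3 * logHeight₁ x + C := by
  refine ⟨logHeight₁ (n ^ 2 / 4) + 2 * logHeight₁ (n / 2) + 3 * (totalWeight ℚ * Real.log 2),
    fun x y h => ?_⟩
  have h1 := logHeight₁_add_le (x ^ 3) (n ^ 2 / 4)
  rw [show x ^ 3 + n ^ 2 / 4 = (y + n / 2) ^ 2 by rw [← h]; ring, logHeight₁_pow, logHeight₁_pow]
    at h1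
  have h2 := logHeight₁_sub_le (y + n / 2) (n / 2)
  rw [add_sub_cancel_right] at h2
  push_cast at h1
  linarith

/-- A crude chord estimate: the slope costs 1 + 3/2 times the height of P, its square 5, and
subtracting the abscissa of P one more. Any factor below 9 suffices for the descent by tripling. -/
theorem exists_xHeight_add_le (R : (cubicCurve n).toAffine.Point) :
    ∃ c : ℝ, ∀ P, xHeight (R + P) ≤ 6 * xHeight P + c := by
  rcases R with _ | ⟨x₁, y₁, h₁⟩
  · refine ⟨0, fun P => ?_⟩
    change xHeight (0 + P) ≤ _
    rw [zero_add]
    linarith [xHeight_nonneg P]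
  obtain ⟨C, hC⟩ := exists_logHeight₁_ordinate_le n
  set R := Affine.Point.some x₁ y₁ h₁
  set κ : ℝ := totalWeight ℚ * Real.log 2 with hκ
  have hκ0 : 0 ≤ κ := by positivity
  refine ⟨xHeight R + xHeight (R + R) + |C| + 2 * logHeight₁ y₁ + 3 * logHeight₁ x₁ + 6 * κ,
    fun P => ?_⟩
  have a1 := xHeight_nonneg R
  have a2 := xHeight_nonneg (R + R)
  have a3 := abs_nonneg C
  have a4 := zero_le_logHeight₁ y₁
  have a5 := zero_le_logHeight₁ x₁
  have a6 := xHeight_nonneg P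
  by_cases hP : P = 0 ∨ P = R ∨ P = -R
  · rcases hP with rfl | rfl | rfl
    · rw [add_zero]; linarith
    · linarith
    · rw [add_neg_cancel, xHeight_zero]; linarith
  push Not at hP
  rcases P with _ | ⟨x₂, y₂, h₂⟩
  · exact (hP.1 rfl).elim
  have hx : x₁ ≠ x₂ := by
    intro hx
    rcases Affine.Point.X_eq_iff (h₁ := h₂) (h₂ := h₁) |>.1 hx.symm with h | h
    · exact hP.2.1 h
    · exact hP.2.2 h
  obtain ⟨l, x₃, y₃, hl, -, hx₃, -, -, h₃, e⟩ := cubicCurve_add_eq_some h₁ h₂ fun h => hx h.1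
  rw [e, xHeight_some, xHeight_some, hx₃]
  have hl' : l = (y₁ - y₂) * (x₁ - x₂)⁻¹ := by
    rw [← hl, mul_inv_cancel_right₀ (sub_ne_zero.2 hx)]
  have b1 := logHeight₁_sub_le (l ^ 2 - x₁) x₂
  have b2 := logHeight₁_sub_le (l ^ 2) x₁
  have b3 := logHeight₁_mul_le (y₁ - y₂) (x₁ - x₂)⁻¹
  have b4 := logHeight₁_sub_le y₁ y₂
  have b5 := logHeight₁_sub_le x₁ x₂
  have b6 := hC x₂ y₂ ((cubicCurve_equation_iff _ _ _).1 h₂.1)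
  have b7 := le_abs_self C
  rw [← hl', logHeight₁_inv] at b3
  rw [logHeight₁_pow] at b2
  push_cast at b2
  rw [← hκ] at b1 b2 b4 b5
  linarith

/-- On abscissas tripling is x ↦ X = (x³ + n²)/x² followed by X ↦ (X³ - 27n²)/(9X²), and each map
triples the height up to a constant. The excluded abscissas x = 0 and x³ = -n² have bounded height.
-/
theorem exists_xHeight_three_nsmul_ge (hn : n ≠ 0) :
    ∃ c : ℝ, ∀ P : (cubicCurve n).toAffine.Point, 9 * xHeight P - c ≤ xHeight (3 • P) := by
  obtain ⟨C₁, h₁⟩ := exists_three_mul_logHeight₁_le (a := n ^ 2) (b := 1) (by positivity) one_ne_zero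
  obtain ⟨C₂, h₂⟩ := exists_three_mul_logHeight₁_le (a := -27 * n ^ 2) (b := 9)
    (mul_ne_zero (by norm_num) (by positivity)) (by norm_num)
  refine ⟨3 * |C₁| + |C₂| + 3 * logHeight₁ (n ^ 2), fun P => ?_⟩
  have a1 := xHeight_nonneg (3 • P)
  have a2 := abs_nonneg C₁
  have a3 := abs_nonneg C₂
  have a4 := zero_le_logHeight₁ (n ^ 2)
  rcases P with _ | ⟨x, y, h⟩
  · change 9 * 0 - _ ≤ _
    linarith
  by_cases hx : x = 0
  · have : logHeight₁ x = 0 := by rw [hx, logHeight₁_zero]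
    rw [xHeight_some, this]; linarith
  by_cases hxn : x ^ 3 + n ^ 2 = 0
  · have : 3 * logHeight₁ x = logHeight₁ (n ^ 2) := by
      rw [← logHeight₁_neg (n ^ 2), show -n ^ 2 = x ^ 3 by linarith, logHeight₁_pow]
      norm_num
    rw [xHeight_some]; linarith
  obtain ⟨x', y', h', e, hx'⟩ := cubicCurve_three_nsmul h hx hxn
  have b1 := h₁ x hx
  have b2 := h₂ ((x ^ 3 + n ^ 2) / (1 * x ^ 2)) (by positivity)
  have : (((x ^ 3 + n ^ 2) / (1 * x ^ 2)) ^ 3 + -27 * n ^ 2) /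
      (9 * ((x ^ 3 + n ^ 2) / (1 * x ^ 2)) ^ 2) = x' := by
    field_simp
    linear_combination -hx'
  rw [this] at b2
  rw [e, xHeight_some, xHeight_some]
  linarith [le_abs_self C₁, le_abs_self C₂]

theorem fg_of_finiteIndex (hn : n ≠ 0)
    (h : (nsmulAddMonoidHom (α := (cubicCurve n).toAffine.Point) 3).range.FiniteIndex) :
    AddGroup.FG (cubicCurve n).toAffine.Point := by
  obtain ⟨c₀, hc₀⟩ := exists_xHeight_three_nsmul_ge hn
  choose c hc using exists_xHeight_add_le (n := n)
  refine AddCommGroup.fg_of_descent (n := 3) (h := xHeight) (a := 6) (b := 9) (c₀ := c₀)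
    (c := fun g => c (-g)) (by norm_num) (by norm_num) h (fun g x => ?_) hc₀
  simpa using hc (-g) (g + x)

end

/-! ### Ranks of finitely generated abelian groups from the quotient by `3` -/

section Rank

variable {A : Type*} [AddCommGroup A]

theorem exists_surjective_of_finrank [Module.Finite ℤ A] :
    ∃ g : A →+ (Fin (Module.finrank ℤ A) → ZMod 3), Function.Surjective g ∧
      ∀ t ∈ Submodule.torsion ℤ A, g t = 0 := by
  let T := Submodule.torsion ℤ A
  have hr : Module.finrank ℤ (A ⧸ T) = Module.finrank ℤ A := by
    have h1 := Submodule.finrank_quotient_add_finrank (R := ℤ) T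
    have h2 : Module.finrank ℤ T = 0 :=
      Module.finrank_eq_zero_iff_isTorsion.2 Submodule.torsion_isTorsion
    rwa [h2, add_zero] at h1
  let b := Module.finBasisOfFinrankEq ℤ (A ⧸ T) hr
  let c : (Fin (Module.finrank ℤ A) → ℤ) →+ (Fin (Module.finrank ℤ A) → ZMod 3) :=
    (Int.castAddHom (ZMod 3)).compLeft _
  have hb : Function.Surjective fun a : A => b.equivFun (T.mkQ a) :=
    b.equivFun.surjective.comp T.mkQ_surjective
  refine ⟨c.comp (b.equivFun.toLinearMap.toAddMonoidHom.comp T.mkQ.toAddMonoidHom), ?_, ?_⟩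
  · intro v
    choose w hw using fun i => ZMod.intCast_surjective (v i)
    obtain ⟨a, ha⟩ := hb w
    refine ⟨a, ?_⟩
    change c (b.equivFun (T.mkQ a)) = v
    rw [show b.equivFun (T.mkQ a) = w from ha]
    exact funext hw
  · intro t ht
    have : T.mkQ t = 0 := (Submodule.Quotient.mk_eq_zero T).2 ht
    simp [this]

/-- A finitely generated abelian group of rank `r` with nontrivial `3`-torsion has more than `3 ^ r`
classes modulo `3`. -/
theorem finrank_le_of_index_le [AddGroup.FG A] {t : A} (ht : t ≠ 0) (h3 : 3 • t = 0) {s : ℕ}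
    (h0 : (nsmulAddMonoidHom (α := A) 3).range.index ≠ 0)
    (hs : (nsmulAddMonoidHom (α := A) 3).range.index ≤ 3 ^ (s + 1)) :
    Module.finrank ℤ A ≤ s := by
  have : Module.Finite ℤ A := Module.Finite.iff_addGroup_fg.2 inferInstance
  have mem_torsion {a : A} {m : ℕ} (hm : m ≠ 0) (h : m • a = 0) : a ∈ Submodule.torsion ℤ A := by
    rw [Submodule.mem_torsion_iff]
    exact ⟨⟨m, mem_nonZeroDivisors_of_ne_zero (by exact_mod_cast hm)⟩, by
      simpa [Submonoid.smul_def] using h⟩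
  obtain ⟨g, hg, hgT⟩ := exists_surjective_of_finrank (A := A)
  have hle : (nsmulAddMonoidHom (α := A) 3).range ≤ g.ker := by
    rintro _ ⟨a, rfl⟩
    rw [AddMonoidHom.mem_ker, nsmulAddMonoidHom_apply, map_nsmul]
    funext i
    rw [Pi.smul_apply, nsmul_eq_mul]
    exact mul_eq_zero_of_left (by decide) _
  have hindex : g.ker.index = 3 ^ Module.finrank ℤ A := by
    rw [AddSubgroup.index_ker, AddMonoidHom.range_eq_top.2 hg]
    simp
  have hnot : ¬ g.ker ≤ (nsmulAddMonoidHom (α := A) 3).range := by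
    have hfin : Finite (Submodule.torsion ℤ A) :=
      Module.finite_of_fg_torsion _ Submodule.torsion_isTorsion
    -- On the finite torsion subgroup tripling is not injective, hence not surjective. A torsion
    -- element it misses is not in 3A either, because a third of a torsion element is torsion; yet
    -- `g` kills it.
    have hinj : ¬ Function.Injective fun a : Submodule.torsion ℤ A => 3 • a := by
      intro hinj
      have := @hinj ⟨t, mem_torsion (by norm_num) h3⟩ 0 (by ext; simpa using h3)
      exact ht (congrArg Subtype.val this)
    rw [Finite.injective_iff_surjective] at hinj
    simp only [Function.Surjective, not_forall] at hinj
    obtain ⟨a, ha⟩ := hinj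
    intro hle'
    obtain ⟨b, hb⟩ := hle' (AddMonoidHom.mem_ker.2 (hgT a a.2))
    rw [nsmulAddMonoidHom_apply] at hb
    obtain ⟨m, hm, hma⟩ := (isOfFinAddOrder_iff_nsmul_eq_zero).1 (isOfFinAddOrder_of_finite a)
    refine ha ⟨⟨b, mem_torsion (m := m * 3) (by omega) ?_⟩, by ext; simpa using hb⟩
    rw [mul_nsmul', hb]
    exact congrArg Subtype.val hma
  have hmul := AddSubgroup.relIndex_mul_index hle
  rw [hindex] at hmul
  have h1 : (nsmulAddMonoidHom (α := A) 3).range.relIndex g.ker ≠ 1 := by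
    rwa [Ne, AddSubgroup.relIndex_eq_one]
  have h2 : (nsmulAddMonoidHom (α := A) 3).range.relIndex g.ker ≠ 0 := by
    intro h2; rw [h2, zero_mul] at hmul; exact h0 hmul.symm
  have hlt : 3 ^ Module.finrank ℤ A < 3 ^ (s + 1) := by
    refine lt_of_lt_of_le ?_ hs
    rw [← hmul]
    exact lt_mul_of_one_lt_left (by positivity) (by omega)
  exact Nat.lt_succ_iff.1 ((Nat.pow_lt_pow_iff_right (by norm_num)).1 hlt)

/-- If all kernel elements of `f` are multiples of `3`, then the index of `3A` is bounded by the
size of the target of `f`. -/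
theorem index_le_of_ker {G : Type*} [AddCommGroup G] [Finite G] (f : A →+ G)
    (hf : ∀ a, f a = 0 → ∃ b, 3 • b = a) :
    (nsmulAddMonoidHom (α := A) 3).range.index ≠ 0 ∧
      (nsmulAddMonoidHom (α := A) 3).range.index ≤ Nat.card G := by
  have hle : f.ker ≤ (nsmulAddMonoidHom (α := A) 3).range := fun a ha => hf a ha
  have h1 := AddSubgroup.index_dvd_of_le hle
  rw [AddSubgroup.index_ker] at h1
  have h0 : Nat.card f.range ≠ 0 := Nat.card_ne_zero.2 ⟨⟨0⟩, inferInstance⟩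
  exact ⟨fun h => h0 (by rwa [h, zero_dvd_iff] at h1),
    (Nat.le_of_dvd (Nat.pos_of_ne_zero h0) h1).trans
      (Nat.le_of_dvd Nat.card_pos (AddSubgroup.card_addSubgroup_dvd_card _))⟩

/-- A finitely generated abelian group with few elements of order `3` and many classes modulo `3`
has positive rank. -/
theorem finrank_pos_of_ker_card_lt [AddGroup.FG A] {G : Type*} [AddCommGroup G] [Finite G]
    (f : A →+ G) (hG : ∀ x : G, 3 • x = 0)
    (h : Nat.card (nsmulAddMonoidHom (α := A) 3).ker < Nat.card f.range) :
    0 < Module.finrank ℤ A := by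
  have : Module.Finite ℤ A := Module.Finite.iff_addGroup_fg.2 inferInstance
  by_contra! h0
  have hfin : Finite A := Module.finite_of_fg_torsion A
    (Module.finrank_eq_zero_iff_isTorsion.1 (Nat.le_zero.1 h0))
  have hle : (nsmulAddMonoidHom (α := A) 3).range ≤ f.ker := by
    rintro _ ⟨a, rfl⟩
    rw [AddMonoidHom.mem_ker, nsmulAddMonoidHom_apply, map_nsmul, hG]
  have h1 := AddSubgroup.index_dvd_of_le hle
  -- For finite A the quotient A/3A has as many elements as A[3].
  rw [AddSubgroup.index_ker, AddSubgroup.index_range] at h1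
  exact absurd (Nat.le_of_dvd Nat.card_pos h1) (not_le.2 h)

end Rank

/-! ### The ranks of the six curves -/

section Torsion

variable {n : ℚ}

theorem cubicCurve_nonsingular_zero (hn : n ≠ 0) : (cubicCurve n).toAffine.Nonsingular 0 0 :=
  (cubicCurve_nonsingular_iff hn 0 0).2 (by ring)

/-- The point `(0, 0)` of `y² + n y = x³`, of order `3`. -/
def torsionPoint (hn : n ≠ 0) : (cubicCurve n).toAffine.Point :=
  .some 0 0 (cubicCurve_nonsingular_zero hn)

theorem three_nsmul_torsionPoint (hn : n ≠ 0) : 3 • torsionPoint hn = 0 := by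
  have h := cubicCurve_nonsingular_zero hn
  obtain ⟨l, x₃, y₃, -, h1, hx₃, hy₃, -, h₃, e⟩ := cubicCurve_add_eq_some h h
    (fun h' => hn (by linarith [h'.2]))
  obtain ⟨-, -, hl⟩ := h1 rfl
  have hl0 : l = 0 := by simpa [hn] using hl
  have hx0 : x₃ = 0 := by rw [hx₃, hl0]; ring
  have hy0 : y₃ = -0 - n := by rw [hy₃, hl0]; ring
  rw [succ_nsmul, two_nsmul, torsionPoint, e]
  exact Affine.Point.add_of_Y_eq hx0 (by rw [cubicCurve_negY, hy0])

theorem torsionPoint_ne_zero (hn : n ≠ 0) : torsionPoint hn ≠ 0 := Affine.Point.some_ne_zero _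

theorem descentHom_torsionPoint {p : ℕ} [Fact p.Prime] (hn : n ≠ 0) :
    descentHom p hn (torsionPoint hn) = -valModThree p n := by
  rw [torsionPoint, descentHom_some, ordinateClass, if_pos rfl]

theorem eq_of_abscissa_zero (hn : n ≠ 0) {y : ℚ} (h : (cubicCurve n).toAffine.Nonsingular 0 y) :
    Affine.Point.some 0 y h = torsionPoint hn ∨ Affine.Point.some 0 y h = -torsionPoint hn :=
  Affine.Point.X_eq_iff.1 rfl

theorem card_three_torsion_le (hn : n ≠ 0) (hcube : ∀ x : ℚ, x ^ 3 + n ^ 2 ≠ 0) :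
    Nat.card (nsmulAddMonoidHom (α := (cubicCurve n).toAffine.Point) 3).ker ≤ 3 := by
  classical
  let S : Finset (cubicCurve n).toAffine.Point := {0, torsionPoint hn, -torsionPoint hn}
  have hsub : ((nsmulAddMonoidHom (α := (cubicCurve n).toAffine.Point) 3).ker : Set _) ⊆
      (S : Set (cubicCurve n).toAffine.Point) := by
    intro P hP
    rcases P with _ | ⟨x, y, h⟩
    · simp [S, Affine.Point.zero_def]
    by_cases hx : x = 0
    · subst hx
      rcases eq_of_abscissa_zero hn h with h | h <;> simp [S, h]
    · obtain ⟨x', y', h', e, -⟩ := cubicCurve_three_nsmul h hx (hcube x)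
      have : 3 • Affine.Point.some x y h = 0 := hP
      rw [e] at this
      exact (Affine.Point.some_ne_zero _ this).elim
  have := Set.ncard_le_ncard hsub (Finset.finite_toSet _)
  rw [Set.ncard_coe_finset] at this
  exact this.trans Finset.card_le_three

end Torsion

/-- The exponent s + 1 rather than s in the bound on G pays for the rational point (0, 0) of order
3. -/
theorem fg_and_finrank_le {n : ℚ} (hn : n ≠ 0) {G : Type*} [AddCommGroup G] [Finite G]
    (f : (cubicCurve n).toAffine.Point →+ G) (hf : ∀ P, f P = 0 → ∃ R, 3 • R = P) {s : ℕ}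
    (hG : Nat.card G ≤ 3 ^ (s + 1)) :
    AddGroup.FG (cubicCurve n).toAffine.Point ∧
      Module.finrank ℤ (cubicCurve n).toAffine.Point ≤ s := by
  obtain ⟨h0, hle⟩ := index_le_of_ker f hf
  have hfg := fg_of_finiteIndex hn ⟨h0⟩
  exact ⟨hfg, finrank_le_of_index_le (torsionPoint_ne_zero hn) (three_nsmul_torsionPoint hn) h0
    (hle.trans hG)⟩

theorem descentHom_eq_zero {n : ℚ} {p : ℕ} [Fact p.Prime] (hn : n ≠ 0) (hpn : padicValRat p n = 0)
    (P : (cubicCurve n).toAffine.Point) : descentHom p hn P = 0 := by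
  rcases P with _ | ⟨x, y, h⟩
  · exact map_zero _
  · rw [descentHom_some, ordinateClass]
    split_ifs
    · rw [valModThree, hpn]; simp
    · rw [valModThree, ZMod.intCast_zmod_eq_zero_iff_dvd]
      exact three_dvd_padicValRat hn hpn ((cubicCurve_equation_iff _ _ _).1 h.1)

theorem padicValRat_two_pow_mul_five_pow (i j : ℕ) :
    padicValRat 2 ((2 : ℚ) ^ i * 5 ^ j) = i ∧ padicValRat 5 ((2 : ℚ) ^ i * 5 ^ j) = j := by
  have h25 : padicValRat 2 (5 : ℚ) = 0 := by
    have := padicValRat_intCast_eq_zero (q := 2) (n := 5) (by norm_num)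
    rwa [Int.cast_ofNat] at this
  have h52 : padicValRat 5 (2 : ℚ) = 0 := by
    have := padicValRat_intCast_eq_zero (q := 5) (n := 2) (by norm_num)
    rwa [Int.cast_ofNat] at this
  have h22 : padicValRat 2 (2 : ℚ) = 1 := by
    exact_mod_cast padicValRat.self (p := 2) (by norm_num)
  have h55 : padicValRat 5 (5 : ℚ) = 1 := by
    exact_mod_cast padicValRat.self (p := 5) (by norm_num)
  constructor <;> rw [padicValRat.mul (by positivity) (by positivity), padicValRat.pow,
    padicValRat.pow]
  · rw [h22, h25]; ring
  · rw [h52, h55]; ring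

theorem valModThree_two_pow_mul_five_pow {n : ℚ} (i j : ℕ) (hn : n = 2 ^ i * 5 ^ j) :
    valModThree 2 n = i ∧ valModThree 5 n = j := by
  obtain ⟨h2, h5⟩ := padicValRat_two_pow_mul_five_pow i j
  rw [valModThree, valModThree, hn, h2, h5]
  simp

theorem finrank_cubicCurve_le_one {n : ℤ} (hn : n ∣ 100) {p : ℕ} [Fact p.Prime] (hp : p = 2 ∨ p = 5)
    (hpn : (p : ℤ) ∣ n) (hv : valModThree p n ≠ 0) :
    AddGroup.FG (cubicCurve (n : ℚ)).toAffine.Point ∧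
      Module.finrank ℤ (cubicCurve (n : ℚ)).toAffine.Point ≤ 1 := by
  have hn0 : (n : ℚ) ≠ 0 := by
    rintro h0
    exact hv (by simp [h0, valModThree])
  refine fg_and_finrank_le hn0 ((descentHom 2 hn0).prod (descentHom 5 hn0)) (fun P hP => ?_) ?_
  · rw [AddMonoidHom.prod_apply, Prod.mk_eq_zero] at hP
    exact exists_three_nsmul_eq hn hp hpn hv hn0 P hP.1 hP.2
  · simp

theorem finrank_cubicCurve_eq_zero {n : ℤ} (hn : n ∣ 100) {p q : ℕ} [Fact p.Prime] [Fact q.Prime]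
    (hpq : p = 2 ∧ q = 5 ∨ p = 5 ∧ q = 2) (hpn : (p : ℤ) ∣ n) (hv : valModThree p n ≠ 0)
    (hqn : ¬ (q : ℤ) ∣ n) : Module.finrank ℤ (cubicCurve (n : ℚ)).toAffine.Point = 0 := by
  have hn0 : (n : ℚ) ≠ 0 := by
    rintro h0
    exact hv (by simp [h0, valModThree])
  refine Nat.le_zero.1 (fg_and_finrank_le hn0 (descentHom p hn0) (fun P hP => ?_) (by simp)).2
  have hq := descentHom_eq_zero hn0 (padicValRat_intCast_eq_zero hqn) P
  rcases hpq with ⟨rfl, rfl⟩ | ⟨rfl, rfl⟩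
  · exact exists_three_nsmul_eq hn (Or.inl rfl) hpn hv hn0 P hP hq
  · exact exists_three_nsmul_eq hn (Or.inr rfl) hpn hv hn0 P hq hP

theorem finrank_cubicCurve_two : Module.finrank ℤ (cubicCurve (2 : ℚ)).toAffine.Point = 0 := by
  have := finrank_cubicCurve_eq_zero (n := 2) (p := 2) (q := 5) (by norm_num) (Or.inl ⟨rfl, rfl⟩)
    (by norm_num) (by
      rw [(valModThree_two_pow_mul_five_pow 1 0 (by norm_num)).1]; decide) (by norm_num)
  exact_mod_cast this

theorem finrank_cubicCurve_five : Module.finrank ℤ (cubicCurve (5 : ℚ)).toAffine.Point = 0 := by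
  have := finrank_cubicCurve_eq_zero (n := 5) (p := 5) (q := 2) (by norm_num) (Or.inr ⟨rfl, rfl⟩)
    (by norm_num) (by
      rw [(valModThree_two_pow_mul_five_pow 0 1 (by norm_num)).2]; decide) (by norm_num)
  exact_mod_cast this

theorem finrank_cubicCurve_twentyFive :
    Module.finrank ℤ (cubicCurve (25 : ℚ)).toAffine.Point = 0 := by
  have := finrank_cubicCurve_eq_zero (n := 25) (p := 5) (q := 2) (by norm_num) (Or.inr ⟨rfl, rfl⟩)
    (by norm_num) (by
      rw [(valModThree_two_pow_mul_five_pow 0 2 (by norm_num)).2]; decide) (by norm_num)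
  exact_mod_cast this

theorem finrank_cubicCurve_ten_le :
    Module.finrank ℤ (cubicCurve (10 : ℚ)).toAffine.Point ≤ 1 := by
  have := (finrank_cubicCurve_le_one (n := 10) (p := 2) (by norm_num) (Or.inl rfl)
    (by norm_num) (by
      rw [(valModThree_two_pow_mul_five_pow 1 1 (by norm_num)).1]; decide)).2
  exact_mod_cast this

theorem finrank_cubicCurve_fifty :
    Module.finrank ℤ (cubicCurve (50 : ℚ)).toAffine.Point = 1 := by
  obtain ⟨hfg, hle⟩ : AddGroup.FG (cubicCurve (50 : ℚ)).toAffine.Point ∧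
      Module.finrank ℤ (cubicCurve (50 : ℚ)).toAffine.Point ≤ 1 := by
    have := finrank_cubicCurve_le_one (n := 50) (p := 2) (by norm_num) (Or.inl rfl)
      (by norm_num) (by
        rw [(valModThree_two_pow_mul_five_pow 1 2 (by norm_num)).1]; decide)
    exact_mod_cast this
  refine le_antisymm hle ?_
  have h50 : (50 : ℚ) ≠ 0 := by norm_num
  have h2 := valModThree_two_pow_mul_five_pow (n := 50) 1 2 (by norm_num)
  have h4 := valModThree_two_pow_mul_five_pow (n := 4) 2 0 (by norm_num)
  have hP : (cubicCurve (50 : ℚ)).toAffine.Nonsingular 6 4 :=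
    (cubicCurve_nonsingular_iff h50 6 4).2 (by norm_num)
  let f := (descentHom 2 h50).prod (descentHom 5 h50)
  have hfP : f (.some 6 4 hP) = (2, 0) := by
    rw [AddMonoidHom.prod_apply, descentHom_some, descentHom_some, ordinateClass, ordinateClass,
      if_neg (by norm_num), if_neg (by norm_num), h4.1, h4.2]
    rfl
  have hfT : f (torsionPoint h50) = (2, 1) := by
    rw [AddMonoidHom.prod_apply, descentHom_torsionPoint, descentHom_torsionPoint, h2.1, h2.2]
    decide
  have hrange : f.range = ⊤ := by
    rw [eq_top_iff]
    rintro ⟨a, b⟩ -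
    -- The coefficients solve β(2, 1) + α(2, 0) = (a, b) over 𝔽₃.
    refine ⟨b.val • torsionPoint h50 + (2 * a + 2 * b).val • .some 6 4 hP, ?_⟩
    rw [map_add, map_nsmul, map_nsmul, hfP, hfT]
    revert a b
    decide
  refine finrank_pos_of_ker_card_lt f (by decide)
    (lt_of_le_of_lt (card_three_torsion_le h50 fun x hx => ?_) ?_)
  · have h3 : 3 ∣ padicValRat 2 ((50 : ℚ) ^ 2) := by
      rw [show (50 : ℚ) ^ 2 = -x ^ 3 by linarith, padicValRat.neg, padicValRat.pow]
      exact dvd_mul_right _ _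
    rw [show (50 : ℚ) ^ 2 = 2 ^ 2 * 5 ^ 4 by norm_num,
      (padicValRat_two_pow_mul_five_pow 2 4).1] at h3
    norm_num at h3
  · rw [hrange]
    simp

/-- For n = 1 no prime obstructs, so y = s³ and y + 1 = (x/s)³, contradicting Fermat's theorem for
exponent 3 unless x = 0. -/
theorem abscissa_eq_zero_of_sq_add {x y : ℚ} (h : y ^ 2 + 1 * y = x ^ 3) : x = 0 := by
  by_contra hx
  have hy : y ≠ 0 := by
    rintro rfl
    exact hx (pow_eq_zero_iff (n := 3) (by norm_num) |>.1 (by rw [← h]; norm_num))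
  obtain ⟨s, hs⟩ := Rat.exists_eq_cube (y := y) fun p hp => by
    have := Fact.mk hp
    exact three_dvd_padicValRat one_ne_zero (by simp) h
  have hs0 : s ≠ 0 := by rintro rfl; exact hy (by rw [hs]; norm_num)
  refine fermatLastTheoremFor_iff_rat.1 fermatLastTheoremThree s 1 (x / s) hs0 one_ne_zero
    (div_ne_zero hx hs0) ?_
  rw [div_pow, ← hs, ← h]
  field_simp

theorem finrank_cubicCurve_one : Module.finrank ℤ (cubicCurve (1 : ℚ)).toAffine.Point = 0 := by
  have hfin : Finite (cubicCurve (1 : ℚ)).toAffine.Point := by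
    refine Set.finite_univ_iff.1 (Set.Finite.subset
      (s := {0, torsionPoint one_ne_zero, -torsionPoint one_ne_zero}) (Set.toFinite _) ?_)
    rintro (_ | ⟨x, y, h⟩) -
    · exact Or.inl rfl
    · obtain rfl := abscissa_eq_zero_of_sq_add ((cubicCurve_equation_iff _ _ _).1 h.1)
      exact Or.inr (eq_of_abscissa_zero one_ne_zero h)
  rw [Module.finrank_eq_zero_iff_isTorsion]
  intro P
  obtain ⟨m, hm, h⟩ := (isOfFinAddOrder_iff_nsmul_eq_zero).1 (isOfFinAddOrder_of_finite P)
  exact ⟨⟨m, mem_nonZeroDivisors_of_ne_zero (by exact_mod_cast hm.ne')⟩, by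
    simpa [Submonoid.smul_def] using h⟩

/-! ### Cubes in the completions of `ℚ` -/

theorem PadicInt.exists_cube_eq {p : ℕ} [Fact p.Prime] {a b : ℤ}
    (h : ‖((b ^ 3 - a : ℤ) : ℤ_[p])‖ < ‖((3 * b ^ 2 : ℤ) : ℤ_[p])‖ ^ 2) :
    ∃ c : ℤ_[p], c ^ 3 = (a : ℤ_[p]) := by
  obtain ⟨z, hz, -⟩ := hensels_lemma (p := p) (R := ℤ) (F := .X ^ 3 - .C a) (a := (b : ℤ_[p])) (by
    have h3 : Polynomial.aeval (b : ℤ_[p]) (3 : Polynomial ℤ) = 3 := map_ofNat _ 3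
    simpa [h3] using h)
  refine ⟨z, ?_⟩
  simpa [sub_eq_zero] using hz

theorem PadicInt.exists_cube_eq_of_dvd {p : ℕ} [Fact p.Prime] (hp3 : p ≠ 3) {a b : ℤ}
    (hpb : ¬ (p : ℤ) ∣ b) (h : (p : ℤ) ∣ b ^ 3 - a) : ∃ c : ℤ_[p], c ^ 3 = (a : ℤ_[p]) := by
  have hp := Fact.out (p := p.Prime)
  refine PadicInt.exists_cube_eq (b := b) ?_
  have h1 : ‖((3 * b ^ 2 : ℤ) : ℤ_[p])‖ = 1 := by
    refine le_antisymm (PadicInt.norm_le_one _) (not_lt.1 ?_)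
    rw [PadicInt.norm_int_lt_one_iff_dvd]
    intro hd
    rcases (Nat.prime_iff_prime_int.1 hp).dvd_or_dvd hd with h3 | hb
    · have : p ∣ 3 := by exact_mod_cast h3
      exact hp3 ((Nat.prime_dvd_prime_iff_eq hp Nat.prime_three).1 this)
    · exact hpb ((Nat.prime_iff_prime_int.1 hp).dvd_of_dvd_pow hb)
  rw [h1, one_pow]
  exact PadicInt.norm_int_lt_one_iff_dvd _ |>.2 h

/-- If x ≠ 1 it generates Q, so y is 1, x or x². With x = 5 and y = 2 this produces the list 5, 2,
10, 50. -/
theorem eq_one_or_of_card_dvd_three {Q : Type*} [CommGroup Q] (hQ : Nat.card Q ∣ 3) (x y : Q) :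
    x = 1 ∨ y = 1 ∨ y * x = 1 ∨ y * x ^ 2 = 1 := by
  rcases (Nat.dvd_prime Nat.prime_three).1 hQ with h | h
  · have := (Nat.card_eq_one_iff_unique.1 h).1
    exact Or.inl (Subsingleton.elim _ _)
  · by_cases hx : x = 1
    · exact Or.inl hx
    have : Fact (Nat.Prime 3) := ⟨Nat.prime_three⟩
    obtain ⟨k, hk⟩ := Subgroup.mem_zpowers_iff.1 (mem_zpowers_of_prime_card h hx (g' := y))
    have hx3 : x ^ (3 : ℤ) = 1 := by
      have := pow_card_eq_one' (x := x)
      rw [h] at this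
      exact_mod_cast this
    have hk' : y = x ^ (k % 3) := by
      rw [← hk]
      conv_lhs => rw [← Int.emod_add_mul_ediv k 3, zpow_add, zpow_mul, hx3, one_zpow, mul_one]
    have : k % 3 = 0 ∨ k % 3 = 1 ∨ k % 3 = 2 := by omega
    rcases this with h | h | h <;> rw [h] at hk'
    · exact Or.inr (Or.inl (by simpa using hk'))
    · refine Or.inr (Or.inr (Or.inr ?_))
      rw [hk', ← hx3, ← zpow_natCast, ← zpow_add]; rfl
    · refine Or.inr (Or.inr (Or.inl ?_))
      rw [hk', ← hx3, ← zpow_add_one]; rfl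

theorem ZMod.exists_cube_eq {p : ℕ} [Fact p.Prime] {x y : ZMod p} (hx : x ≠ 0) (hy : y ≠ 0) :
    ∃ c : ZMod p, c ≠ 0 ∧ (c ^ 3 = x ∨ c ^ 3 = y ∨ c ^ 3 = y * x ∨ c ^ 3 = y * x ^ 2) := by
  let H := (powMonoidHom 3 : (ZMod p)ˣ →* (ZMod p)ˣ).range
  have hH : Nat.card ((ZMod p)ˣ ⧸ H) ∣ 3 := by
    rw [← Subgroup.index_eq_card, IsCyclic.index_powMonoidHom_range]
    exact Nat.gcd_dvd_right _ _
  have key {u : (ZMod p)ˣ} (h : (u : (ZMod p)ˣ ⧸ H) = 1) : ∃ c : ZMod p, c ≠ 0 ∧ c ^ 3 = u := by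
    obtain ⟨c, rfl⟩ := (QuotientGroup.eq_one_iff u).1 h
    exact ⟨c, c.ne_zero, by simp⟩
  rcases eq_one_or_of_card_dvd_three hH (Units.mk0 x hx : (ZMod p)ˣ) (Units.mk0 y hy : (ZMod p)ˣ)
    with h | h | h | h
  · obtain ⟨c, h0, hc⟩ := key h
    exact ⟨c, h0, Or.inl hc⟩
  · obtain ⟨c, h0, hc⟩ := key h
    exact ⟨c, h0, Or.inr (Or.inl hc)⟩
  · obtain ⟨c, h0, hc⟩ := key h
    exact ⟨c, h0, Or.inr (Or.inr (Or.inl (by simpa using hc)))⟩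
  · obtain ⟨c, h0, hc⟩ := key h
    exact ⟨c, h0, Or.inr (Or.inr (Or.inr (by simpa using hc)))⟩

/-- In a field `k`, one of `5`, `2`, `10`, `50` is a cube. -/
def HasCubeInList (k : Type*) [Field k] : Prop :=
  ∃ c : k, c ^ 3 = 5 ∨ c ^ 3 = 2 ∨ c ^ 3 = 10 ∨ c ^ 3 = 50

theorem HasCubeInList.of_ringEquiv {k k' : Type*} [Field k] [Field k'] (e : k ≃+* k')
    (h : HasCubeInList k') : HasCubeInList k := by
  obtain ⟨c, hc⟩ := h
  refine ⟨e.symm c, ?_⟩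
  rw [← map_pow]
  rcases hc with h | h | h | h <;> rw [h, map_ofNat] <;> simp

theorem hasCubeInList_padic (p : ℕ) [Fact p.Prime] : HasCubeInList ℚ_[p] := by
  have hp := Fact.out (p := p.Prime)
  have lift {a : ℤ} (h : ∃ c : ℤ_[p], c ^ 3 = (a : ℤ_[p])) : ∃ c : ℚ_[p], c ^ 3 = (a : ℚ_[p]) := by
    obtain ⟨c, hc⟩ := h
    exact ⟨c, by rw [← PadicInt.coe_pow, hc, PadicInt.coe_intCast]⟩
  by_cases h2 : p = 2
  · subst h2
    obtain ⟨c, hc⟩ := lift (PadicInt.exists_cube_eq_of_dvd (p := 2) (a := 5) (b := 1) (by norm_num)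
      (by norm_num) (by norm_num))
    exact ⟨c, Or.inl (by exact_mod_cast hc)⟩
  by_cases h5 : p = 5
  · subst h5
    obtain ⟨c, hc⟩ := lift (PadicInt.exists_cube_eq_of_dvd (p := 5) (a := 2) (b := 3) (by norm_num)
      (by norm_num) (by norm_num))
    exact ⟨c, Or.inr (Or.inl (by exact_mod_cast hc))⟩
  -- At 3 the derivative is not a unit: 4³ - 10 = 2·3³ has absolute value 3⁻³, below |3·4²|² = 3⁻².
  by_cases h3 : p = 3
  · subst h3
    obtain ⟨c, hc⟩ := lift (PadicInt.exists_cube_eq (p := 3) (a := 10) (b := 4) (by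
      have h1 : ‖((4 ^ 3 - 10 : ℤ) : ℤ_[3])‖ ≤ (3 : ℝ) ^ (-3 : ℤ) := by
        have := (PadicInt.norm_int_le_pow_iff_dvd (p := 3) (k := 4 ^ 3 - 10) (n := 3)).2 (by norm_num)
        exact_mod_cast this
      have h3 : ‖((3 * 4 ^ 2 : ℤ) : ℤ_[3])‖ = 1 / 3 := by
        have e : ((3 * 4 ^ 2 : ℤ) : ℤ_[3]) = (3 : ℕ) * ((4 ^ 2 : ℤ) : ℤ_[3]) := by push_cast; ring
        rw [e, norm_mul, PadicInt.norm_p]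
        have : ‖((4 ^ 2 : ℤ) : ℤ_[3])‖ = 1 := by
          refine le_antisymm (PadicInt.norm_le_one _) (not_lt.1 ?_)
          rw [PadicInt.norm_int_lt_one_iff_dvd]
          norm_num
        rw [this]; norm_num
      rw [h3]
      refine h1.trans_lt ?_
      norm_num))
    exact ⟨c, Or.inr (Or.inr (Or.inl (by exact_mod_cast hc)))⟩
  have ne (q : ℕ) (hq : q.Prime) (hpq : p ≠ q) : ((q : ℕ) : ZMod p) ≠ 0 := by
    rw [Ne, ZMod.natCast_eq_zero_iff]
    exact fun h => hpq ((Nat.prime_dvd_prime_iff_eq hp hq).1 h)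
  obtain ⟨c, hc0, hc⟩ := ZMod.exists_cube_eq (ne 5 Nat.prime_five h5) (ne 2 Nat.prime_two h2)
  obtain ⟨b, rfl⟩ := ZMod.intCast_surjective c
  rw [Ne, ZMod.intCast_zmod_eq_zero_iff_dvd] at hc0
  have key {a : ℤ} (h : (b : ZMod p) ^ 3 = (a : ZMod p)) : ∃ c : ℚ_[p], c ^ 3 = (a : ℚ_[p]) := by
    refine lift (PadicInt.exists_cube_eq_of_dvd h3 hc0 ?_)
    rw [← ZMod.intCast_zmod_eq_zero_iff_dvd]
    push_cast
    rw [h, sub_self]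
  rcases hc with h | h | h | h
  · obtain ⟨c, hc⟩ := key (a := 5) (by exact_mod_cast h)
    exact ⟨c, Or.inl (by exact_mod_cast hc)⟩
  · obtain ⟨c, hc⟩ := key (a := 2) (by exact_mod_cast h)
    exact ⟨c, Or.inr (Or.inl (by exact_mod_cast hc))⟩
  · obtain ⟨c, hc⟩ := key (a := 2 * 5) (by exact_mod_cast h)
    exact ⟨c, Or.inr (Or.inr (Or.inl (by rw [hc]; norm_num)))⟩
  · obtain ⟨c, hc⟩ := key (a := 2 * 5 ^ 2) (by exact_mod_cast h)
    exact ⟨c, Or.inr (Or.inr (Or.inr (by rw [hc]; norm_num)))⟩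

theorem hasCubeInList_adicCompletion (v : HeightOneSpectrum (𝓞 ℚ)) :
    HasCubeInList (v.adicCompletion ℚ) := by
  have : Fact (Nat.Prime (Rat.HeightOneSpectrum.primesEquiv v)) :=
    ⟨(Rat.HeightOneSpectrum.primesEquiv v).2⟩
  exact (hasCubeInList_padic _).of_ringEquiv
    (Rat.HeightOneSpectrum.adicCompletion.padicEquiv v).toRingEquiv

theorem hasCubeInList_infinitePlace_completion (v : InfinitePlace ℚ) :
    HasCubeInList v.Completion := by
  rcases v.isReal_or_isComplex with h | h
  · refine HasCubeInList.of_ringEquiv (InfinitePlace.Completion.ringEquivRealOfIsReal h)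
      ⟨5 ^ ((3 : ℝ)⁻¹), Or.inl ?_⟩
    exact_mod_cast Real.rpow_inv_natCast_pow (x := 5) (n := 3) (by norm_num) (by norm_num)
  · obtain ⟨c, hc⟩ := IsAlgClosed.exists_pow_nat_eq (5 : ℂ) (n := 3) (by norm_num)
    exact HasCubeInList.of_ringEquiv (InfinitePlace.Completion.ringEquivComplexOfIsComplex h)
      ⟨c, Or.inl hc⟩

/-! ### The rank is not a sum of local invariants -/

instance cubicCurve_isElliptic_of_neZero {k : Type*} [Field k] [CharZero k] {n : k} [NeZero n] :
    (cubicCurve n).IsElliptic :=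
  cubicCurve_isElliptic (NeZero.ne n)

instance neZero_rat_five : NeZero (5 : ℚ) := ⟨by norm_num⟩

instance neZero_rat_ten : NeZero (10 : ℚ) := ⟨by norm_num⟩

instance neZero_rat_twentyFive : NeZero (25 : ℚ) := ⟨by norm_num⟩

instance neZero_rat_fifty : NeZero (50 : ℚ) := ⟨by norm_num⟩

/-! ### The congruence modulo 3 at each place, and the contradiction. -/

section Local

variable {k : Type} [Field k] [TopologicalSpace k] [IsLocalField k] [Algebra ℚ k]

/-- The value of a local invariant on the base change of `y² + n y = x³` to `k`. -/
def LocalInvariant.cubicValue {A : Type*} (l : LocalInvariant A) (k : Type) [Field k]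
    [TopologicalSpace k] [IsLocalField k] [Algebra ℚ k] (n : ℚ) [NeZero n] : A :=
  l.toFun k ((cubicCurve n).map (algebraMap ℚ k))

theorem LocalInvariant.cubicValue_eq {A : Type*} (l : LocalInvariant A) {m n : ℚ} [NeZero m]
    [NeZero n] {c : k} (h : (algebraMap ℚ k m) = algebraMap ℚ k n * c ^ 3) :
    l.cubicValue k m = l.cubicValue k n := by
  have hc : c ≠ 0 := by
    rintro rfl
    rw [zero_pow three_ne_zero, mul_zero, map_eq_zero] at h
    exact NeZero.ne m h
  -- The substitution with scaling unit c divides the coefficient a₃ by c³.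
  refine l.iso_invariant k k (RingEquiv.refl k) continuous_id continuous_id _ _
    ⟨Units.mk0 c hc, 0, 0, 0⟩ ?_
  have h3 : (c ^ 3)⁻¹ * (m : k) = (n : k) := by
    rw [← eq_ratCast (algebraMap ℚ k), ← eq_ratCast (algebraMap ℚ k), h]
    field_simp
  ext <;> simp [WeierstrassCurve.variableChange_def, cubicCurve, WeierstrassCurve.map, h3]

theorem LocalInvariant.three_dvd_cubicValue (l : LocalInvariant ℤ) (h : HasCubeInList k) :
    3 ∣ l.cubicValue k 1 + l.cubicValue k 5 + l.cubicValue k 25 -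
      l.cubicValue k 2 - l.cubicValue k 10 - l.cubicValue k 50 := by
  have := algebraRat.charZero k
  obtain ⟨c, h | h | h | h⟩ := h
  · have e1 : l.cubicValue k 5 = l.cubicValue k 1 :=
      l.cubicValue_eq (c := c) (by simp [h])
    have e2 : l.cubicValue k 25 = l.cubicValue k 5 :=
      l.cubicValue_eq (c := c) (by simp [h]; norm_num)
    have e3 : l.cubicValue k 10 = l.cubicValue k 2 :=
      l.cubicValue_eq (c := c) (by simp [h]; norm_num)
    have e4 : l.cubicValue k 50 = l.cubicValue k 10 :=
      l.cubicValue_eq (c := c) (by simp [h]; norm_num)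
    omega
  · have e1 : l.cubicValue k 2 = l.cubicValue k 1 :=
      l.cubicValue_eq (c := c) (by simp [h])
    have e2 : l.cubicValue k 10 = l.cubicValue k 5 :=
      l.cubicValue_eq (c := c) (by simp [h]; norm_num)
    have e3 : l.cubicValue k 50 = l.cubicValue k 25 :=
      l.cubicValue_eq (c := c) (by simp [h]; norm_num)
    omega
  · have e1 : l.cubicValue k 10 = l.cubicValue k 1 :=
      l.cubicValue_eq (c := c) (by simp [h])
    have e2 : l.cubicValue k 50 = l.cubicValue k 5 :=
      l.cubicValue_eq (c := c) (by simp [h]; norm_num)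
    -- With c³ = 10, 2/25 = 10/125 is the cube of c/5.
    have e3 : l.cubicValue k 2 = l.cubicValue k 25 :=
      l.cubicValue_eq (c := c / 5) (by simp [h, div_pow]; norm_num)
    omega
  · have e1 : l.cubicValue k 50 = l.cubicValue k 1 :=
      l.cubicValue_eq (c := c) (by simp [h])
    have e2 : l.cubicValue k 2 = l.cubicValue k 5 :=
      l.cubicValue_eq (c := c / 5) (by simp [h, div_pow]; norm_num)
    have e3 : l.cubicValue k 10 = l.cubicValue k 25 :=
      l.cubicValue_eq (c := c / 5) (by simp [h, div_pow]; norm_num)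
    omega

end Local

theorem mordellWeilRank_cubicCurve (n : ℚ) [NeZero n] :
    mordellWeilRank ℚ (cubicCurve n) = Module.finrank ℤ (cubicCurve n).toAffine.Point := by
  unfold mordellWeilRank
  -- The two sides differ only in the decidable equality used to define the group law.
  congr!

theorem three_dvd_mordellWeilRank (h : IsSumOfLocalInvariants mordellWeilRank) :
    3 ∣ mordellWeilRank ℚ (cubicCurve 1) + mordellWeilRank ℚ (cubicCurve 5) +
      mordellWeilRank ℚ (cubicCurve 25) - mordellWeilRank ℚ (cubicCurve 2) -
      mordellWeilRank ℚ (cubicCurve 10) - mordellWeilRank ℚ (cubicCurve 50) := by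
  classical
  obtain ⟨l, hl⟩ := h
  have hl (n : ℚ) [NeZero n] :
      (Function.support fun v : HeightOneSpectrum (𝓞 ℚ) ↦
        l.cubicValue (v.adicCompletion ℚ) n).Finite ∧
      mordellWeilRank ℚ (cubicCurve n) =
        (∑ᶠ v : HeightOneSpectrum (𝓞 ℚ), l.cubicValue (v.adicCompletion ℚ) n) +
        ∑ v : InfinitePlace ℚ, l.cubicValue v.Completion n := hl ℚ (cubicCurve n)
  -- One finite set of places carrying all six sums, so that the congruence can be added up place by
  -- place.
  let S := (hl 1).1.toFinset ∪ (hl 5).1.toFinset ∪ (hl 25).1.toFinset ∪ (hl 2).1.toFinset ∪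
    (hl 10).1.toFinset ∪ (hl 50).1.toFinset
  have key (n : ℚ) [NeZero n] (hS : (hl n).1.toFinset ⊆ S) :
      mordellWeilRank ℚ (cubicCurve n) = (∑ v ∈ S, l.cubicValue (v.adicCompletion ℚ) n) +
        ∑ v : InfinitePlace ℚ, l.cubicValue v.Completion n := by
    rw [(hl n).2, finsum_eq_sum_of_support_subset _ (s := S) (by
      simpa [Set.Finite.toFinset_subset] using hS)]
  rw [key 1, key 5, key 25, key 2, key 10, key 50]
  · have h1 := Finset.dvd_sum (s := S) fun v _ =>
      l.three_dvd_cubicValue (hasCubeInList_adicCompletion v)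
    have h2 := Finset.dvd_sum (s := Finset.univ) fun v _ =>
      l.three_dvd_cubicValue (hasCubeInList_infinitePlace_completion v)
    simp only [Finset.sum_add_distrib, Finset.sum_sub_distrib] at h1 h2
    omega
  all_goals
    intro v hv
    simp only [S, Finset.mem_union]
    tauto

theorem theorem1 : ¬ IsSumOfLocalInvariants mordellWeilRank := by
  intro h
  have h3 := three_dvd_mordellWeilRank h
  simp only [mordellWeilRank_cubicCurve, finrank_cubicCurve_one, finrank_cubicCurve_two,
    finrank_cubicCurve_five, finrank_cubicCurve_twentyFive, finrank_cubicCurve_fifty] at h3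
  have h10 := finrank_cubicCurve_ten_le
  -- What remains is 3 ∣ -rk E₁₀ - 1 with rk E₁₀ equal to 0 or 1.
  omega
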